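/- Let $\mathbb F_q$ be a finite field of odd characteristic with $q$ elements, and let $k$ be an algebraic closure of $\mathbb F_q$. For a symmetric space $(G,K)$ over $k$ with Lie algebras $\mathfrak g\supseteq\mathfrak k$, put $\mathfrak p=\mathfrak g/\mathfrak k$, with the adjoint action of $K$, and let $\mathcal N\subseteq\mathfrak p$ be the set of nilpotent elements, i.e. of those $x\in\mathfrak p$ such that the (Zariski) closure of the $K$-orbit of $x$ in $\mathfrak p$ contains $0$. If $(G,K)$ is defined over $\mathbb F_q$, let $\mathcal N(\mathbb F_q)$ be the set of $\mathbb F_q$-rational points of $\mathcal N$. (1) Let $V$ be a $2n$-dimensional vector space over $\mathbb F_q$ with a nondegenerate symplectic form, and let $(G,K)=(GL(V),Sp(V))$ with the resulting (split) $\mathbb F_q$-structure. Then $|\mathcal N(\mathbb F_q)|=q^{2n^2-2n}$; in particular it is an even power of $q$. (2) Let $V$ be an $N$-dimensional vector space over $\mathbb F_q$, $N\ge 2$, with a nondegenerate symmetric bilinear form $(\,,)$, let $U\subset V$ be a subspace of codimension one on which $(\,,)$ is nondegenerate, and let $(G,K)=(SO(V),SO(U))$ with the resulting $\mathbb F_q$-structure.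 If $N$ is even, then $$|\mathcal N(\mathbb F_q)|=q^{N-2}.$$ If $N$ is odd, then $$|\mathcal N(\mathbb F_q)|=q^{N-2}\pm\bigl(q^{(N-1)/2}-q^{(N-3)/2}\bigr),$$ where the sign is $+$ if the restriction of $(\,,)$ to $U$ is split over $\mathbb F_q$ (that is, $U$ contains a totally isotropic $\mathbb F_q$-subspace of dimension $(N-1)/2$), and $-$ otherwise. -/

import Mathlib

open scoped TensorProduct

noncomputable section

namespace SymmetricSpace

/-- The algebra of polynomial functions on a `k`-vector space `M`: the subalgebra of all functions
`M → k` generated by the linear forms. -/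
def polynomialFunctions (k M : Type*) [Field k] [AddCommGroup M] [Module k M] :
    Subalgebra k (M → k) :=
  Algebra.adjoin k (Set.range fun φ : Module.Dual k M => (φ : M → k))

/-- The Zariski closure of a subset of a (finite-dimensional) `k`-vector space: the common zeros of
all polynomial functions that vanish on the subset. -/
def zariskiClosure (k : Type*) {M : Type*} [Field k] [AddCommGroup M] [Module k M] (S : Set M) :
    Set M :=
  {x | ∀ f ∈ polynomialFunctions k M, (∀ y ∈ S, f y = 0) → f x = 0}

/-- For linear Lie algebras `𝔨 ⊆ 𝔤 ⊆ End W`, the vector space `𝔭 = 𝔤 / 𝔨`. -/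
abbrev LieQuotient {k W : Type*} [Field k] [AddCommGroup W] [Module k W]
    (𝔤 𝔨 : Submodule k (Module.End k W)) : Type _ :=
  ↥𝔤 ⧸ 𝔨.submoduleOf 𝔤

/-- The class in `𝔭 = 𝔤 / 𝔨` of an element of `𝔤`. -/
def toLieQuotient {k W : Type*} [Field k] [AddCommGroup W] [Module k W]
    (𝔤 𝔨 : Submodule k (Module.End k W)) : 𝔤 →ₗ[k] LieQuotient 𝔤 𝔨 :=
  (𝔨.submoduleOf 𝔤).mkQ

/-- The orbit of `x ∈ 𝔭 = 𝔤 / 𝔨` under the adjoint action of a group `K ⊆ GL(W)`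
(whose conjugation action on `End W` preserves `𝔤` and `𝔨`): it consists of the classes
of `g X g⁻¹`, where `g ∈ K` and `X ∈ 𝔤` represents `x`. -/
def adjointOrbit {k W : Type*} [Field k] [AddCommGroup W] [Module k W]
    {𝔤 𝔨 : Submodule k (Module.End k W)} (K : Subgroup (W ≃ₗ[k] W)) (x : LieQuotient 𝔤 𝔨) :
    Set (LieQuotient 𝔤 𝔨) :=
  {y | ∃ g ∈ K, ∃ X Y : 𝔤, (Y : Module.End k W) = g.conj (X : Module.End k W) ∧
    toLieQuotient 𝔤 𝔨 X = x ∧ toLieQuotient 𝔤 𝔨 Y = y}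

/-- The set `𝒩` of nilpotent elements of `𝔭 = 𝔤 / 𝔨`: those elements for which the closure
of the `K`-orbit in `𝔭` contains `0`. -/
def nilpotentElements {k W : Type*} [Field k] [AddCommGroup W] [Module k W]
    (𝔤 𝔨 : Submodule k (Module.End k W)) (K : Subgroup (W ≃ₗ[k] W)) : Set (LieQuotient 𝔤 𝔨) :=
  {x | 0 ∈ zariskiClosure k (adjointOrbit K x)}

/-- The `F`-rational points of a subset `S` of `𝔭 = 𝔤 / 𝔨`, where `𝔨 ⊆ 𝔤 ⊆ End (k ⊗ V)` have the
`F`-forms `𝔨₀ ⊆ 𝔤₀ ⊆ End V`: the elements of `𝔭(F) = 𝔤₀ / 𝔨₀` whose image in `𝔭`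
under extension of scalars lies in `S`. -/
def rationalPoints {F k V : Type*} [Field F] [Field k] [Algebra F k] [AddCommGroup V] [Module F V]
    (𝔤₀ 𝔨₀ : Submodule F (Module.End F V)) {𝔤 𝔨 : Submodule k (Module.End k (k ⊗[F] V))}
    (S : Set (LieQuotient 𝔤 𝔨)) : Set (LieQuotient 𝔤₀ 𝔨₀) :=
  {x | ∃ (X₀ : 𝔤₀) (X : 𝔤), toLieQuotient 𝔤₀ 𝔨₀ X₀ = x ∧
    (X : Module.End k (k ⊗[F] V)) = (X₀ : Module.End F V).baseChange k ∧
    toLieQuotient 𝔤 𝔨 X ∈ S}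

/-- The group of linear automorphisms preserving a bilinear form: `Sp(W)` if `B` is symplectic,
`O(W)` if `B` is symmetric and nondegenerate. -/
def isometryGroup {k W : Type*} [Field k] [AddCommGroup W] [Module k W]
    (B : LinearMap.BilinForm k W) : Subgroup (W ≃ₗ[k] W) where
  carrier := {g | ∀ x y, B (g x) (g y) = B x y}
  one_mem' := fun _ _ => rfl
  mul_mem' := by
    intro a b ha hb x y
    rw [LinearEquiv.mul_apply, LinearEquiv.mul_apply, ha, hb]
  inv_mem' := by
    intro a ha x y
    have h := ha (a⁻¹ x) (a⁻¹ y)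
    have e : ∀ z, a (a⁻¹ z) = z := fun z => LinearEquiv.apply_symm_apply a z
    rw [e, e] at h
    exact h.symm

/-- The Lie algebra of `isometryGroup B` (characteristic different from 2): the endomorphisms `X`
with `B (X x) y + B x (X y) = 0`. -/
def isometryLie {k W : Type*} [Field k] [AddCommGroup W] [Module k W]
    (B : LinearMap.BilinForm k W) : Submodule k (Module.End k W) where
  carrier := {X | ∀ x y, B (X x) y + B x (X y) = 0}
  zero_mem' := by intro x y; simp
  add_mem' := by
    intro X Y hX hY x y
    have h1 := hX x y
    have h2 := hY x y
    simp only [LinearMap.add_apply, map_add]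
    linear_combination h1 + h2
  smul_mem' := by
    intro c X hX x y
    have h1 := hX x y
    simp only [LinearMap.smul_apply, map_smul, smul_eq_mul]
    linear_combination c * h1

/-- `SO(U)` embedded in `SO(W)`, for a nondegenerate symmetric form `B` on `W` and a subspace `U`
on which `B` is nondegenerate: the isometries of determinant one that are the identity on `U^⊥`. -/
def specialOrthogonalOf {k W : Type*} [Field k] [AddCommGroup W] [Module k W]
    (B : LinearMap.BilinForm k W) (U : Submodule k W) : Subgroup (W ≃ₗ[k] W) :=
  isometryGroup B ⊓ (LinearEquiv.det (R := k) (M := W)).ker ⊓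
    fixingSubgroup (W ≃ₗ[k] W) (B.orthogonal U : Set W)

/-- The Lie algebra `𝔰𝔬(U)` embedded in `𝔰𝔬(W)`: the elements of `𝔰𝔬(W)` that vanish on `U^⊥`. -/
def specialOrthogonalLieOf {k W : Type*} [Field k] [AddCommGroup W] [Module k W]
    (B : LinearMap.BilinForm k W) (U : Submodule k W) : Submodule k (Module.End k W) where
  carrier := {X | X ∈ isometryLie B ∧ ∀ v ∈ B.orthogonal U, X v = 0}
  zero_mem' := ⟨Submodule.zero_mem _, fun _ _ => rfl⟩
  add_mem' := by
    intro X Y hX hY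
    refine ⟨Submodule.add_mem _ hX.1 hY.1, fun v hv => ?_⟩
    rw [LinearMap.add_apply, hX.2 v hv, hY.2 v hv, add_zero]
  smul_mem' := by
    intro c X hX
    refine ⟨Submodule.smul_mem _ c hX.1, fun v hv => ?_⟩
    rw [LinearMap.smul_apply, hX.2 v hv, smul_zero]

/-- `𝒩(F)` for `(G, K) = (GL(V), Sp(V))`, where `V` is a vector space over `F` with a symplectic
form `ω`, and `k` is an algebraic closure of `F`. Here `𝔤 = End V` and `𝔨 = 𝔰𝔭(V)`. -/
def nilpotentPointsGLSp {F : Type*} (k : Type*) {V : Type*} [Field F] [Field k] [Algebra F k]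
    [AddCommGroup V] [Module F V] (ω : LinearMap.BilinForm F V) :
    Set (LieQuotient (⊤ : Submodule F (Module.End F V)) (isometryLie ω)) :=
  rationalPoints ⊤ (isometryLie ω)
    (nilpotentElements ⊤ (isometryLie (ω.baseChange k)) (isometryGroup (ω.baseChange k)))

/-- `𝒩(F)` for `(G, K) = (SO(V), SO(U))`, where `V` is a vector space over `F` with a symmetric
form `B`, `U` is a subspace of `V`, and `k` is an algebraic closure of `F`.
Here `𝔤 = 𝔰𝔬(V)` and `𝔨 = 𝔰𝔬(U)`. -/
def nilpotentPointsSO {F : Type*} (k : Type*) {V : Type*} [Field F] [Field k] [Algebra F k]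
    [AddCommGroup V] [Module F V] (B : LinearMap.BilinForm F V) (U : Submodule F V) :
    Set (LieQuotient (isometryLie B) (specialOrthogonalLieOf B U)) :=
  rationalPoints (isometryLie B) (specialOrthogonalLieOf B U)
    (nilpotentElements (isometryLie (B.baseChange k))
      (specialOrthogonalLieOf (B.baseChange k) (U.baseChange k))
      (specialOrthogonalOf (B.baseChange k) (U.baseChange k)))

/-- The restriction of `B` to the even-dimensional subspace `U` is split: `U` contains a totally
isotropic subspace of half its dimension. -/
def IsSplitOn {F V : Type*} [Field F] [AddCommGroup V] [Module F V]
    (B : LinearMap.BilinForm F V) (U : Submodule F V) : Prop :=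
  ∃ L : Submodule F V, L ≤ U ∧ 2 * Module.finrank F L = Module.finrank F U ∧
    ∀ x ∈ L, ∀ y ∈ L, B x y = 0

end SymmetricSpace

end

/-! In both cases 𝔭 is identified with a concrete space, orbit-closure nilpotency becomes an
elementary condition that descends from k to F, and the points are counted over F.

Symplectic case. The kernel of X ↦ X + X* (adjoint with respect to ω) is 𝔰𝔭, and on self-adjoint X,
those with ω(Xx, x) = 0, the map is multiplication by 2. So 𝔭 is the space of self-adjoint
endomorphisms. The characteristic polynomial is invariant under Sp, so orbit-nilpotent implies
nilpotent. Conversely, for nilpotent X ≠ 0 pick e ≠ 0 in im X ∩ ker X. A one-parameter torus scaling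
e degenerates X to its compression to the complement of a hyperbolic plane through e, which has
smaller rank (`mem_nilpotentElements_iff_isNilpotent_addAdjoint`).

To count nilpotent self-adjoint X, fix v ≠ 0 and follow v, Xv, X²v, … . These vectors span an
isotropic subspace and are independent until they reach 0. If a prescribed chain ends in 0, its last
nonzero vector can be split off with a hyperbolic partner, which gives the exact count
(`natCard_chain_kill`). If the chain W = ⟨e_0, …, e_d⟩ continues, the next vector lies in W^⊥ \ W.
The number of X that stop equals |W| times the number for one prescribed continuation, so the sum
over W^⊥ \ W and the stopping term add up to |W^⊥| times that number, again a power of q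
(`natCard_chain`).

Orthogonal case. If v spans U^⊥, then X ↦ Xv identifies 𝔭 with U. The quadratic form on U is an
invariant, and a nonzero isotropic vector is scaled to 0 by a torus of SO(U), so 𝒩 is the isotropic
cone. Its points are counted by peeling off hyperbolic planes. -/

namespace SymmetricSpace

/-! ### Hyperbolic pairs, treated uniformly for symmetric (ε = 1) and alternating (ε = -1) forms -/

section Hyperbolic

variable {F V : Type*} [Field F] [AddCommGroup V] [Module F V]

/-- `B` is `ε`-symmetric and `e`, `f` is a hyperbolic pair for `B`. -/
structure IsHyperbolicPair (B : LinearMap.BilinForm F V) (ε : F) (e f : V) : Prop where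
  sq : ε * ε = 1
  swap : ∀ x y, B y x = ε * B x y
  left : B e e = 0
  right : B f f = 0
  pair : B e f = 1

/-- The orthogonal complement of the plane spanned by `e` and `f`. -/
def hyperbolicComplement (B : LinearMap.BilinForm F V) (e f : V) : Submodule F V :=
  LinearMap.ker (B e) ⊓ LinearMap.ker (B f)

theorem mem_hyperbolicComplement {B : LinearMap.BilinForm F V} {e f w : V} :
    w ∈ hyperbolicComplement B e f ↔ B e w = 0 ∧ B f w = 0 := by
  simp [hyperbolicComplement]

namespace IsHyperbolicPair

variable {B : LinearMap.BilinForm F V} {ε : F} {e f : V}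

theorem pair' (h : IsHyperbolicPair B ε e f) : B f e = ε := by
  rw [h.swap e f, h.pair, mul_one]

/-- The orthogonal projection to the complement of a hyperbolic plane. -/
def proj (_ : IsHyperbolicPair B ε e f) : V →ₗ[F] V :=
  LinearMap.id - (B e).smulRight f - (ε • B f).smulRight e

theorem proj_apply (h : IsHyperbolicPair B ε e f) (w : V) :
    h.proj w = w - B e w • f - (ε * B f w) • e := by
  simp [proj]

theorem proj_mem (h : IsHyperbolicPair B ε e f) (w : V) :
    h.proj w ∈ hyperbolicComplement B e f := by
  rw [mem_hyperbolicComplement, h.proj_apply]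
  simp only [map_sub, map_smul, smul_eq_mul, h.left, h.right, h.pair, h.pair']
  constructor
  · ring
  · linear_combination (-(B f w)) * h.sq

theorem proj_eq_self (h : IsHyperbolicPair B ε e f) {w : V}
    (hw : w ∈ hyperbolicComplement B e f) : h.proj w = w := by
  rw [mem_hyperbolicComplement] at hw
  simp [h.proj_apply, hw.1, hw.2]

theorem proj_left (h : IsHyperbolicPair B ε e f) : h.proj e = 0 := by
  simp [h.proj_apply, h.left, h.pair', h.sq]

theorem proj_right (h : IsHyperbolicPair B ε e f) : h.proj f = 0 := by
  simp [h.proj_apply, h.right, h.pair]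

theorem eq_add_proj (h : IsHyperbolicPair B ε e f) (w : V) :
    w = B e w • f + (ε * B f w) • e + h.proj w := by
  rw [h.proj_apply]; abel

theorem orthogonal_left (h : IsHyperbolicPair B ε e f) {w : V}
    (hw : w ∈ hyperbolicComplement B e f) : B w e = 0 ∧ B w f = 0 := by
  rw [mem_hyperbolicComplement] at hw
  rw [h.swap e w, h.swap f w, hw.1, hw.2]
  simp

/-- The decomposition of the space by a hyperbolic pair. -/
def equiv (h : IsHyperbolicPair B ε e f) :
    V ≃ₗ[F] (F × F) × hyperbolicComplement B e f where
  toFun w := ((B e w, B f w), ⟨h.proj w, h.proj_mem w⟩)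
  map_add' x y := by simp
  map_smul' c x := by simp
  invFun p := p.1.1 • f + (ε * p.1.2) • e + p.2
  left_inv w := (h.eq_add_proj w).symm
  right_inv p := by
    obtain ⟨⟨a, b⟩, w, hw⟩ := p
    have hw' := mem_hyperbolicComplement.1 hw
    have h1 : ε * b * ε = b := by linear_combination b * h.sq
    simp [h.left, h.right, h.pair, h.pair', hw'.1, hw'.2, h.proj_left, h.proj_right,
      h.proj_eq_self hw, h1]

theorem finrank_eq [FiniteDimensional F V] (h : IsHyperbolicPair B ε e f) :
    Module.finrank F V = Module.finrank F (hyperbolicComplement B e f) + 2 := by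
  rw [h.equiv.finrank_eq, Module.finrank_prod, Module.finrank_prod, Module.finrank_self]
  omega

/-- For x in the complement, B x w depends only on the projection of w, so a vector orthogonal to
the complement is orthogonal to everything. -/
theorem restrict_nondegenerate (h : IsHyperbolicPair B ε e f) (hB : B.Nondegenerate) :
    (B.restrict (hyperbolicComplement B e f)).Nondegenerate := by
  have hε : ε ≠ 0 := fun h0 => by simpa [h0] using h.sq
  have key : (B.restrict (hyperbolicComplement B e f)).SeparatingLeft := by
    rintro ⟨x, hx⟩ hy
    ext
    refine hB.1 x fun w => ?_
    have h1 := hy ⟨h.proj w, h.proj_mem w⟩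
    have h2 := h.orthogonal_left hx
    rw [h.eq_add_proj w]
    simpa [h2.1, h2.2] using h1
  refine ⟨key, fun x hx => key x fun y => ?_⟩
  have := hx y
  simp only [LinearMap.BilinForm.restrict_apply, LinearMap.domRestrict_apply] at this ⊢
  rw [h.swap, this, mul_zero]

end IsHyperbolicPair

theorem isHyperbolicPair_of_isAlt {B : LinearMap.BilinForm F V} (hB : B.IsAlt) {e f : V}
    (hef : B e f = 1) : IsHyperbolicPair B (-1) e f :=
  ⟨by ring, fun x y => by rw [neg_one_mul]; exact (hB.neg_eq x y).symm, hB e, hB f, hef⟩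

theorem exists_isHyperbolicPair_of_isSymm {B : LinearMap.BilinForm F V} (hB : B.IsSymm)
    (hn : B.Nondegenerate) (h2 : (2 : F) ≠ 0) {e : V} (he : e ≠ 0) (hee : B e e = 0) :
    ∃ f, IsHyperbolicPair B 1 e f := by
  obtain ⟨y, hy⟩ : ∃ y, B e y ≠ 0 := by
    by_contra! hc
    exact he (hn.1 e hc)
  have hs : ∀ x y, B x y = B y x := fun x y => hB.eq x y
  -- Normalise y so that it pairs to 1 with e, then subtract the multiple of e that makes the result
  -- isotropic.
  refine ⟨(B e y)⁻¹ • y - (B y y / (2 * B e y ^ 2)) • e, by ring, fun x y => ?_, hee, ?_, ?_⟩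
  · rw [one_mul, hs]
  · simp only [map_sub, map_smul, LinearMap.sub_apply, LinearMap.smul_apply, smul_eq_mul, hee,
      hs y e]
    field_simp
    ring
  · simp [hee, hy]

open Module

/-- `V` contains a totally isotropic subspace of half its dimension. -/
def IsSplitForm (B : LinearMap.BilinForm F V) : Prop :=
  ∃ L : Submodule F V, 2 * finrank F L = finrank F V ∧ ∀ x ∈ L, ∀ y ∈ L, B x y = 0

/-- Adding e to a half-dimensional isotropic subspace of the complement keeps it isotropic; both
dimensions grow in step, by 1 and by 2. -/
theorem IsHyperbolicPair.isSplitForm [FiniteDimensional F V] {B : LinearMap.BilinForm F V} {e f : V}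
    (h : IsHyperbolicPair B 1 e f)
    (hs : IsSplitForm (B.restrict (hyperbolicComplement B e f))) : IsSplitForm B := by
  obtain ⟨L, hL, hL'⟩ := hs
  have hle : ∀ x ∈ L.map (hyperbolicComplement B e f).subtype,
      x ∈ hyperbolicComplement B e f := by
    rintro _ ⟨x, -, rfl⟩
    exact x.2
  have he : e ∉ L.map (hyperbolicComplement B e f).subtype := fun he => by
    have := (mem_hyperbolicComplement.1 (hle e he)).2
    rw [h.pair'] at this
    exact one_ne_zero this
  have he0 : e ≠ 0 := fun h0 => by
    have he' := h.pair
    rw [h0, map_zero, LinearMap.zero_apply] at he'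
    exact zero_ne_one he'
  refine ⟨L.map (hyperbolicComplement B e f).subtype ⊔ Submodule.span F {e}, ?_, ?_⟩
  · have h1 := Submodule.finrank_sup_add_finrank_inf_eq
      (L.map (hyperbolicComplement B e f).subtype) (Submodule.span F {e})
    have h2 : L.map (hyperbolicComplement B e f).subtype ⊓ Submodule.span F {e} = ⊥ :=
      disjoint_iff.1 (Submodule.disjoint_span_singleton' he0 |>.2 he)
    rw [h2, finrank_bot, finrank_span_singleton he0,
      Submodule.finrank_map_subtype_eq] at h1
    have := h.finrank_eq
    omega
  · intro x hx y hy
    obtain ⟨x, hxs, _, ha, rfl⟩ := Submodule.mem_sup.1 hx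
    obtain ⟨y, hys, _, hb, rfl⟩ := Submodule.mem_sup.1 hy
    obtain ⟨a, rfl⟩ := Submodule.mem_span_singleton.1 ha
    obtain ⟨b, rfl⟩ := Submodule.mem_span_singleton.1 hb
    have e1 := h.orthogonal_left (hle x hxs)
    have e2 := mem_hyperbolicComplement.1 (hle y hys)
    obtain ⟨x, hxL, rfl⟩ := hxs
    obtain ⟨y, hyL, rfl⟩ := hys
    have := hL' x hxL y hyL
    simp at this e1 e2
    simp [this, e1, e2, h.left]

/-- Since e ∈ L pairs nontrivially with f, cutting L by f^⊥ loses exactly one dimension, and the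
result already lies in e^⊥. -/
theorem IsHyperbolicPair.isSplitForm_complement [FiniteDimensional F V]
    {B : LinearMap.BilinForm F V} {e f : V} (h : IsHyperbolicPair B 1 e f) {L : Submodule F V}
    (hL : 2 * finrank F L = finrank F V) (hL' : ∀ x ∈ L, ∀ y ∈ L, B x y = 0) (he : e ∈ L) :
    IsSplitForm (B.restrict (hyperbolicComplement B e f)) := by
  have hle : L ⊓ LinearMap.ker (B f) ≤ hyperbolicComplement B e f := fun x hx =>
    mem_hyperbolicComplement.2 ⟨hL' e he x hx.1, hx.2⟩
  refine ⟨(L ⊓ LinearMap.ker (B f)).submoduleOf (hyperbolicComplement B e f), ?_,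
    fun x hx y hy => hL' x hx.1 y hy.1⟩
  have h1 := ((B f).domRestrict L).finrank_range_add_finrank_ker
  have h2 : LinearMap.range ((B f).domRestrict L) = ⊤ := by
    rw [LinearMap.range_eq_top]
    intro c
    exact ⟨c • ⟨e, he⟩, by simp [h.pair']⟩
  have h3 : LinearMap.ker ((B f).domRestrict L) = (L ⊓ LinearMap.ker (B f)).submoduleOf L := by
    ext x
    simp [Submodule.submoduleOf]
  rw [h2, h3, finrank_top, finrank_self, (Submodule.submoduleOfEquivOfLe inf_le_left).finrank_eq]
    at h1
  rw [(Submodule.submoduleOfEquivOfLe hle).finrank_eq]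
  have := h.finrank_eq
  omega

theorem natCard_isotropic_of_anisotropic {B : LinearMap.BilinForm F V}
    (h : ¬ ∃ e : V, e ≠ 0 ∧ B e e = 0) : Nat.card {v : V // B v v = 0} = 1 := by
  push Not at h
  have : Unique {v : V // B v v = 0} :=
    { default := ⟨0, by simp⟩
      uniq := fun v => Subtype.ext (by
        by_contra hv
        exact h v hv v.2) }
  exact Nat.card_unique

end Hyperbolic

/-! ### Counting isotropic vectors of a quadratic form over a finite field -/

section Quadric

variable {F V : Type*} [Field F] [AddCommGroup V] [Module F V] [Finite F]

open Module

/-- In coordinates the form is 2ab + Q'(w). For each a ≠ 0 the value of b is determined by w; for a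
= 0 the value of b is free and w must be isotropic. The subtraction in the factor q - 1 is avoided
by moving a term to the left. -/
theorem natCard_isotropic_hyperbolic [FiniteDimensional F V] {B : LinearMap.BilinForm F V}
    (h2 : (2 : F) ≠ 0) {e f : V} (h : IsHyperbolicPair B 1 e f) :
    Nat.card {v : V // B v v = 0} + Nat.card F ^ finrank F (hyperbolicComplement B e f) =
      Nat.card F * Nat.card F ^ finrank F (hyperbolicComplement B e f) +
      Nat.card F * Nat.card {v : hyperbolicComplement B e f //
        B.restrict (hyperbolicComplement B e f) v v = 0} := by
  classical
  have := Fintype.ofFinite F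
  set V' := hyperbolicComplement B e f
  have : Finite V' := Module.finite_of_finite F
  rw [← Module.natCard_eq_pow_finrank (K := F) (V := V')]
  have hq : ∀ w : V, B w w = 2 * B e w * B f w + B (h.proj w) (h.proj w) := by
    intro w
    have h3 := h.orthogonal_left (h.proj_mem w)
    have h4 := mem_hyperbolicComplement.1 (h.proj_mem w)
    conv_lhs => rw [h.eq_add_proj w]
    simp only [map_add, map_smul, LinearMap.add_apply, LinearMap.smul_apply, smul_eq_mul,
      h3.1, h3.2, h4.1, h4.2, h.left, h.right, h.pair, h.pair']
    ring
  let E : {v : V // B v v = 0} ≃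
      Σ a : F, {p : F × V' // 2 * a * p.1 + B p.2 p.2 = 0} :=
    { toFun := fun v => ⟨B e v, (B f v, ⟨h.proj v, h.proj_mem v⟩), by
        exact (hq v).symm.trans v.2⟩
      invFun := fun p => ⟨h.equiv.symm ((p.1, p.2.1.1), p.2.1.2), by
        have h5 := h.equiv.apply_symm_apply ((p.1, p.2.1.1), p.2.1.2)
        have h6 : B e (h.equiv.symm ((p.1, p.2.1.1), p.2.1.2)) = p.1 :=
          congrArg (fun z => z.1.1) h5
        have h7 : B f (h.equiv.symm ((p.1, p.2.1.1), p.2.1.2)) = p.2.1.1 :=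
          congrArg (fun z => z.1.2) h5
        have h8 : h.proj (h.equiv.symm ((p.1, p.2.1.1), p.2.1.2)) = p.2.1.2 :=
          congrArg (fun z => (z.2 : V)) h5
        rw [hq, h6, h7, h8, p.2.2]⟩
      left_inv := fun v => Subtype.ext (h.equiv.symm_apply_apply v)
      right_inv := by
        rintro ⟨a, ⟨b, w⟩, hp⟩
        have h5 := h.equiv.apply_symm_apply ((a, b), w)
        have h6 : B e (h.equiv.symm ((a, b), w)) = a := congrArg (fun z => z.1.1) h5
        have h7 : B f (h.equiv.symm ((a, b), w)) = b := congrArg (fun z => z.1.2) h5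
        have h8 : h.proj (h.equiv.symm ((a, b), w)) = w := congrArg (fun z => (z.2 : V)) h5
        simp only [h7, h8]
        congr 1
        rw [Subtype.heq_iff_coe_eq]
        intro x
        rw [h6] }
  have h0 : Nat.card {p : F × V' // 2 * (0 : F) * p.1 + B p.2 p.2 = 0} =
      Nat.card F * Nat.card {v : V' // B.restrict V' v v = 0} := by
    rw [← Nat.card_prod]
    refine Nat.card_congr
      { toFun := fun p => (p.1.1, ⟨p.1.2, by simpa using p.2⟩)
        invFun := fun p => ⟨(p.1, p.2.1), by simpa using p.2.2⟩
        left_inv := fun p => rfl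
        right_inv := fun p => rfl }
  have h1 : ∀ a : F, a ≠ 0 →
      Nat.card {p : F × V' // 2 * a * p.1 + B p.2 p.2 = 0} = Nat.card V' := by
    intro a ha
    refine Nat.card_congr
      { toFun := fun p => p.1.2
        invFun := fun w => ⟨(-(B w w) / (2 * a), w), by field_simp; ring⟩
        left_inv := fun p => ?_
        right_inv := fun p => rfl }
    ext
    · have := p.2
      simp only
      field_simp
      linear_combination -this
    · rfl
  rw [Nat.card_congr E, Nat.card_sigma, ← Finset.add_sum_erase _ _ (Finset.mem_univ (0 : F)), h0,
    Finset.sum_congr rfl (fun a ha => h1 a (Finset.ne_of_mem_erase ha)), Finset.sum_const,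
    Finset.card_erase_of_mem (Finset.mem_univ _), Finset.card_univ, ← Nat.card_eq_fintype_card,
    smul_eq_mul, add_assoc, add_comm]
  congr 1
  rw [← Nat.succ_mul, Nat.succ_eq_add_one, Nat.sub_add_cancel Nat.card_pos]

/-- Diagonalise the form; over a finite field of odd order a x² + b y² + c = 0 is solvable whenever
a and b are nonzero. -/
theorem exists_isotropic_of_three_le_finrank [FiniteDimensional F V]
    {B : LinearMap.BilinForm F V} (hB : B.IsSymm) (h2 : (2 : F) ≠ 0)
    (hV : 3 ≤ finrank F V) : ∃ e : V, e ≠ 0 ∧ B e e = 0 := by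
  classical
  have := Fintype.ofFinite F
  have : Invertible (2 : F) := invertibleOfNonzero h2
  obtain ⟨v, hv⟩ := LinearMap.BilinForm.exists_orthogonal_basis (B := B) ⟨hB.eq⟩
  let i0 : Fin (finrank F V) := ⟨0, by omega⟩
  let i1 : Fin (finrank F V) := ⟨1, by omega⟩
  let i2 : Fin (finrank F V) := ⟨2, by omega⟩
  have ho : ∀ i j, i ≠ j → B (v i) (v j) = 0 := fun i j hij => hv hij
  by_cases ha : B (v i0) (v i0) = 0
  · exact ⟨v i0, v.ne_zero _, ha⟩
  by_cases hb : B (v i1) (v i1) = 0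
  · exact ⟨v i1, v.ne_zero _, hb⟩
  obtain ⟨x, y, hxy⟩ : ∃ x y : F,
      B (v i0) (v i0) * x ^ 2 + (B (v i1) (v i1) * y ^ 2 + B (v i2) (v i2)) = 0 := by
    obtain ⟨x, y, hxy⟩ := FiniteField.exists_root_sum_quadratic (R := F)
      (f := Polynomial.C (B (v i0) (v i0)) * Polynomial.X ^ 2 + Polynomial.C 0 * Polynomial.X +
        Polynomial.C 0)
      (g := Polynomial.C (B (v i1) (v i1)) * Polynomial.X ^ 2 + Polynomial.C 0 * Polynomial.X +
        Polynomial.C (B (v i2) (v i2)))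
      (Polynomial.degree_quadratic ha) (Polynomial.degree_quadratic hb)
      (by
        have hc : ringChar F ≠ 2 := fun hc => h2 (by
          have := ringChar.Nat.cast_ringChar (R := F)
          rw [hc] at this
          exact_mod_cast this)
        have := FiniteField.odd_card_of_char_ne_two hc
        omega)
    exact ⟨x, y, by simpa using hxy⟩
  refine ⟨x • v i0 + y • v i1 + v i2, fun h0 => ?_, ?_⟩
  · have := congrArg (fun z => v.repr z i2) h0
    have h02 : i0 ≠ i2 := by simp [i0, i2]
    have h12 : i1 ≠ i2 := by simp [i1, i2]
    simp [h02, h12] at this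
  · have e1 := ho i0 i1 (by simp [i0, i1])
    have e2 := ho i1 i0 (by simp [i0, i1])
    have e3 := ho i0 i2 (by simp [i0, i2])
    have e4 := ho i2 i0 (by simp [i0, i2])
    have e5 := ho i1 i2 (by simp [i1, i2])
    have e6 := ho i2 i1 (by simp [i1, i2])
    simp only [map_add, map_smul, LinearMap.add_apply, LinearMap.smul_apply, smul_eq_mul,
      e1, e2, e3, e4, e5, e6]
    linear_combination hxy

theorem natCard_isotropic_of_odd [FiniteDimensional F V] {B : LinearMap.BilinForm F V}
    (hB : B.IsSymm) (hn : B.Nondegenerate) (h2 : (2 : F) ≠ 0) (hV : Odd (finrank F V)) :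
    Nat.card F * Nat.card {v : V // B v v = 0} = Nat.card F ^ finrank F V := by
  obtain ⟨r, hr⟩ := hV
  induction r generalizing V with
  | zero =>
    rw [natCard_isotropic_of_anisotropic, hr]
    · simp
    · rintro ⟨e, he, hee⟩
      obtain ⟨f, hf⟩ := exists_isHyperbolicPair_of_isSymm hB hn h2 he hee
      have := hf.finrank_eq
      omega
  | succ r ih =>
    obtain ⟨e, he, hee⟩ := exists_isotropic_of_three_le_finrank hB h2 (by omega)
    obtain ⟨f, hf⟩ := exists_isHyperbolicPair_of_isSymm hB hn h2 he hee
    have hd := hf.finrank_eq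
    have h3 := natCard_isotropic_hyperbolic h2 hf
    have h4 := ih (hB.restrict _) (hf.restrict_nondegenerate hn) (by omega)
    have h5 : Nat.card {v : V // B v v = 0} =
        Nat.card F * Nat.card F ^ finrank F (hyperbolicComplement B e f) := by
      rw [h4] at h3
      omega
    rw [h5, hd]
    ring

theorem natCard_isotropic_of_even [FiniteDimensional F V] {B : LinearMap.BilinForm F V}
    (hB : B.IsSymm) (hn : B.Nondegenerate) (h2 : (2 : F) ≠ 0) (r : ℕ)
    (hr : finrank F V = 2 * r) :
    (IsSplitForm B → Nat.card F * Nat.card {v : V // B v v = 0} + Nat.card F ^ r =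
      Nat.card F ^ (2 * r) + Nat.card F ^ (r + 1)) ∧
    (¬ IsSplitForm B → Nat.card F * Nat.card {v : V // B v v = 0} + Nat.card F ^ (r + 1) =
      Nat.card F ^ (2 * r) + Nat.card F ^ r) := by
  induction r generalizing V with
  | zero =>
    have hV := finrank_zero_iff.1 hr
    have h1 := natCard_isotropic_of_anisotropic (B := B)
      (by rintro ⟨e, he, -⟩; exact he (Subsingleton.elim _ _))
    rw [h1]
    refine ⟨fun _ => by ring, fun hs => absurd ⟨⊥, by simp [hr], fun x hx y hy => ?_⟩ hs⟩
    rw [(Submodule.mem_bot F).1 hx]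
    simp
  -- The recurrence is the same whether the form is split or not; only the base differs: dimension 0
  -- for split forms, an anisotropic plane for nonsplit ones.
  | succ r ih =>
    have step : ∀ e f : V, IsHyperbolicPair B 1 e f →
        (IsSplitForm (B.restrict (hyperbolicComplement B e f)) →
          Nat.card F * Nat.card {v : V // B v v = 0} + Nat.card F ^ (r + 1) =
          Nat.card F ^ (2 * (r + 1)) + Nat.card F ^ (r + 1 + 1)) ∧
        (¬ IsSplitForm (B.restrict (hyperbolicComplement B e f)) →
          Nat.card F * Nat.card {v : V // B v v = 0} + Nat.card F ^ (r + 1 + 1) =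
          Nat.card F ^ (2 * (r + 1)) + Nat.card F ^ (r + 1)) := by
      intro e f hf
      have hd := hf.finrank_eq
      have hd' : finrank F (hyperbolicComplement B e f) = 2 * r := by omega
      have h3 := natCard_isotropic_hyperbolic h2 hf
      have h4 := ih (hB.restrict _) (hf.restrict_nondegenerate hn) hd'
      rw [hd'] at h3
      zify at h3 h4 ⊢
      refine ⟨fun hs => ?_, fun hs => ?_⟩
      · linear_combination (Nat.card F : ℤ) * h3 + (Nat.card F : ℤ) * h4.1 hs
      · linear_combination (Nat.card F : ℤ) * h3 + (Nat.card F : ℤ) * h4.2 hs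
    refine ⟨?_, fun hs => ?_⟩
    · rintro ⟨L, hL, hL'⟩
      have : Nontrivial L := Module.nontrivial_of_finrank_pos (R := F) (by omega)
      obtain ⟨e, he⟩ := exists_ne (0 : L)
      obtain ⟨f, hf⟩ := exists_isHyperbolicPair_of_isSymm hB hn h2 (e := e)
        (fun h0 => he (Subtype.ext h0)) (hL' e e.2 e e.2)
      exact (step _ _ hf).1 (hf.isSplitForm_complement hL hL' e.2)
    · by_cases hi : ∃ e : V, e ≠ 0 ∧ B e e = 0
      · obtain ⟨e, he, hee⟩ := hi
        obtain ⟨f, hf⟩ := exists_isHyperbolicPair_of_isSymm hB hn h2 he hee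
        exact (step _ _ hf).2 fun h => hs (hf.isSplitForm h)
      · rw [natCard_isotropic_of_anisotropic hi]
        -- An anisotropic form has dimension at most 2, so this is the anisotropic plane, with 0 as
        -- its only isotropic vector.
        have : r = 0 := by
          by_contra h
          exact hi (exists_isotropic_of_three_le_finrank hB h2 (by omega))
        subst this
        ring

end Quadric

end SymmetricSpace

/-! ### Self-adjoint nilpotents and their compressions -/

namespace SymmetricSpace

open Module

/-- The relation xpx = x² lets p be inserted or deleted between two factors x, so (pxp)^j = p x^j p
for j ≥ 1. For the converse, one extra x on each side absorbs the outer factors p: x^(n+3) = x (p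
x^(n+1) p) x. -/
theorem isNilpotent_compression_iff {R : Type*} [Ring R] {p x : R} (hp : p * p = p)
    (hx : x * p * x = x * x) : IsNilpotent (p * x * p) ↔ IsNilpotent x := by
  have key : ∀ j : ℕ, (p * x * p) ^ (j + 1) = p * x ^ (j + 1) * p := by
    intro j
    induction j with
    | zero => simp
    | succ j ih =>
      rw [pow_succ, ih]
      calc p * x ^ (j + 1) * p * (p * x * p)
          = p * x ^ (j + 1) * (p * p) * x * p := by noncomm_ring
        _ = p * x ^ j * (x * p * x) * p := by simp only [hp, pow_succ, mul_assoc]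
        _ = p * x ^ (j + 1 + 1) * p := by rw [hx]; simp only [pow_succ, mul_assoc]
  constructor
  · rintro ⟨n, hn⟩
    refine ⟨n + 3, ?_⟩
    have h1 := key n
    rw [pow_succ, hn, zero_mul] at h1
    calc x ^ (n + 3) = x ^ n * (x * x) * x := by noncomm_ring
      _ = x ^ (n + 1) * p * (x * x) := by simp only [← hx, pow_succ, mul_assoc]
      _ = x ^ n * (x * x) * p * x := by
        rw [← hx, pow_succ]
        calc x ^ n * x * p * (x * p * x) = x ^ n * (x * p * x) * p * x := by noncomm_ring
          _ = _ := by rw [hx]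
      _ = x * x ^ (n + 1) * p * x := by rw [← pow_succ']; noncomm_ring
      _ = (x * p * x) * x ^ n * p * x := by rw [hx, pow_succ']; noncomm_ring
      _ = x * (p * x ^ (n + 1) * p) * x := by rw [pow_succ']; noncomm_ring
      _ = 0 := by rw [← h1]; simp
  · rintro ⟨n, hn⟩
    refine ⟨n + 1, ?_⟩
    rw [key, pow_succ, hn]
    simp

variable {F : Type*} {V : Type*} [Field F] [AddCommGroup V] [Module F V]

/-- The nilpotent endomorphisms `X` for which the form `ω (X x) y` is alternating. -/
def nilAlt (ω : LinearMap.BilinForm F V) : Set (Module.End F V) :=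
  {X | IsNilpotent X ∧ ∀ x, ω (X x) x = 0}

/-- The elements of `nilAlt ω` mapping `e i` to `e (i + 1)` for `i < d`. -/
def nilAltChain (ω : LinearMap.BilinForm F V) (e : ℕ → V) (d : ℕ) : Set (Module.End F V) :=
  {X | X ∈ nilAlt ω ∧ ∀ i < d, X (e i) = e (i + 1)}

theorem apply_eq_apply_of_alt {ω : LinearMap.BilinForm F V} (hω : ω.IsAlt) {X : Module.End F V}
    (hX : ∀ x, ω (X x) x = 0) (x y : V) : ω (X x) y = ω x (X y) := by
  have h := hX (x + y)
  simp only [map_add, LinearMap.add_apply, hX] at h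
  have := hω.neg_eq (X y) x
  linear_combination h + this

/-- Powers of X move across ω, so it suffices to treat ω(X^n v, v). Splitting n in half turns this
into ω(u, u) or ω(Xu, u) with u = X^k v, and both vanish. -/
theorem apply_pow_eq_zero {ω : LinearMap.BilinForm F V} (hω : ω.IsAlt) {X : Module.End F V}
    (hX : ∀ x, ω (X x) x = 0) (i j : ℕ) (v : V) : ω ((X ^ i) v) ((X ^ j) v) = 0 := by
  have move : ∀ (i : ℕ) (x y : V), ω ((X ^ i) x) y = ω x ((X ^ i) y) := by
    intro i
    induction i with
    | zero => intro x y; rfl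
    | succ i ih =>
      intro x y
      rw [pow_succ', Module.End.mul_apply, apply_eq_apply_of_alt hω hX, ih, ← Module.End.mul_apply,
        ← pow_succ, pow_succ']
  have h0 : ∀ n (v : V), ω ((X ^ n) v) v = 0 := by
    intro n v
    obtain ⟨k, hk | hk⟩ := n.even_or_odd'
    · rw [hk, two_mul, pow_add, Module.End.mul_apply, move]
      exact hω _
    · rw [hk, show 2 * k + 1 = k + (1 + k) by omega, pow_add, Module.End.mul_apply, move,
        pow_add, Module.End.mul_apply, pow_one]
      exact hX _
  rw [← move, ← Module.End.mul_apply, ← pow_add]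
  exact h0 _ _

namespace IsHyperbolicPair

variable {B : LinearMap.BilinForm F V} {ε : F} {e f : V}

/-- The orthogonal projection, with values in the complement of the hyperbolic plane. -/
def projTo (h : IsHyperbolicPair B ε e f) : V →ₗ[F] hyperbolicComplement B e f :=
  h.proj.codRestrict _ h.proj_mem

@[simp]
theorem coe_projTo (h : IsHyperbolicPair B ε e f) (w : V) : (h.projTo w : V) = h.proj w := rfl

theorem projTo_coe (h : IsHyperbolicPair B ε e f) (w : hyperbolicComplement B e f) :
    h.projTo w = w := Subtype.ext (h.proj_eq_self w.2)

theorem proj_mul_proj (h : IsHyperbolicPair B ε e f) : h.proj * h.proj = h.proj :=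
  LinearMap.ext fun w => h.proj_eq_self (h.proj_mem w)

/-- The compression of an endomorphism to the complement of a hyperbolic plane. -/
def compress (h : IsHyperbolicPair B ε e f) (X : Module.End F V) :
    Module.End F (hyperbolicComplement B e f) :=
  h.projTo ∘ₗ X ∘ₗ (hyperbolicComplement B e f).subtype

theorem isNilpotent_compress_iff (h : IsHyperbolicPair B ε e f) {X : Module.End F V}
    (hX : X * h.proj * X = X * X) : IsNilpotent (h.compress X) ↔ IsNilpotent X := by
  rw [← isNilpotent_compression_iff h.proj_mul_proj hX]
  have key : ∀ (n : ℕ) (w : V),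
      ((h.proj * X * h.proj) ^ n) (h.proj w) = ((h.compress X) ^ n) (h.projTo w) := by
    intro n
    induction n with
    | zero => intro w; rfl
    | succ n ih =>
      intro w
      rw [pow_succ, pow_succ, Module.End.mul_apply _ (h.proj * X * h.proj)]
      have h1 : (h.proj * X * h.proj) (h.proj w) = h.proj (X (h.proj w)) := by
        simp [h.proj_eq_self (h.proj_mem w)]
      rw [h1, ih]
      rfl
  constructor
  · rintro ⟨n, hn⟩
    refine ⟨n + 1, LinearMap.ext fun w => ?_⟩
    rw [pow_succ, Module.End.mul_apply]
    have := key n (X (h.proj w))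
    rw [hn] at this
    simpa using this
  · rintro ⟨n, hn⟩
    refine ⟨n, LinearMap.ext fun w => Subtype.ext ?_⟩
    have := key n w
    rw [hn, h.proj_eq_self w.2, h.projTo_coe] at this
    simpa using this.symm

end IsHyperbolicPair

/-! ### Endomorphisms killing one vector of a hyperbolic pair -/

section Reduction

variable {ω : LinearMap.BilinForm F V} {g f : V}

/-- Projecting Xw removes only its f- and g-components: the first is ω(g, Xw) = ω(Xg, w) = 0, and
the second is killed by X. -/
theorem mul_proj_mul (h : IsHyperbolicPair ω (-1) g f) (hω : ω.IsAlt) {X : Module.End F V}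
    (hX : ∀ x, ω (X x) x = 0) (hg : X g = 0) : X * h.proj * X = X * X := by
  ext w
  have h1 : ω g (X w) = 0 := by
    rw [← apply_eq_apply_of_alt hω hX, hg]
    simp
  simp [h.proj_apply, h1, hg]

/-- The endomorphism killing `g`, mapping `f` to `u`, with compression `X'`. -/
def expand (h : IsHyperbolicPair ω (-1) g f) (X' : Module.End F (hyperbolicComplement ω g f))
    (u : V) : Module.End F V :=
  (hyperbolicComplement ω g f).subtype ∘ₗ X' ∘ₗ h.projTo + (ω.flip u).smulRight g
    - (ω.flip g).smulRight u

theorem expand_apply (h : IsHyperbolicPair ω (-1) g f)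
    (X' : Module.End F (hyperbolicComplement ω g f)) (u w : V) :
    expand h X' u w = X' (h.projTo w) + ω w u • g - ω w g • u := by
  simp [expand]

theorem compress_expand (h : IsHyperbolicPair ω (-1) g f)
    (X' : Module.End F (hyperbolicComplement ω g f)) (u : V) :
    h.compress (expand h X' u) = X' := by
  ext w
  have := h.orthogonal_left w.2
  simp only [IsHyperbolicPair.compress, LinearMap.comp_apply, Submodule.subtype_apply,
    expand_apply, map_add, map_sub, map_smul, this.1, h.projTo_coe]
  simp [h.proj_left]

theorem expand_alt (h : IsHyperbolicPair ω (-1) g f) (hω : ω.IsAlt)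
    {X' : Module.End F (hyperbolicComplement ω g f)}
    (hX' : ∀ x, ω.restrict (hyperbolicComplement ω g f) (X' x) x = 0) (u x : V) :
    ω (expand h X' u x) x = 0 := by
  have h1 := hX' (h.projTo x)
  have h2 := h.orthogonal_left (X' (h.projTo x)).2
  have h3 : ω (X' (h.projTo x)) x = 0 := by
    conv_lhs => enter [2]; rw [h.eq_add_proj x]
    simpa [h2] using h1
  have h4 := hω.neg_eq g x
  have h5 := hω.neg_eq u x
  rw [expand_apply]
  simp only [map_add, map_sub, map_smul, LinearMap.add_apply, LinearMap.sub_apply,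
    LinearMap.smul_apply, smul_eq_mul, h3, ← h4, ← h5]
  ring

theorem expand_left (h : IsHyperbolicPair ω (-1) g f)
    (X' : Module.End F (hyperbolicComplement ω g f)) {u : V}
    (hu : u ∈ hyperbolicComplement ω g f) : expand h X' u g = 0 := by
  have h0 : h.projTo g = 0 := Subtype.ext h.proj_left
  simp [expand_apply, h0, h.left, (mem_hyperbolicComplement.1 hu).1]

theorem expand_right (h : IsHyperbolicPair ω (-1) g f)
    (X' : Module.End F (hyperbolicComplement ω g f)) {u : V}
    (hu : u ∈ hyperbolicComplement ω g f) : expand h X' u f = u := by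
  have h0 : h.projTo f = 0 := Subtype.ext h.proj_right
  simp [expand_apply, h0, h.pair', (mem_hyperbolicComplement.1 hu).2]

theorem apply_right_mem (hω : ω.IsAlt) {X : Module.End F V}
    (hX : ∀ x, ω (X x) x = 0) (hg : X g = 0) : X f ∈ hyperbolicComplement ω g f := by
  rw [mem_hyperbolicComplement, ← apply_eq_apply_of_alt hω hX, hg,
    ← apply_eq_apply_of_alt hω hX, hX]
  simp

/-- Self-adjointness and Xg = 0 force Xw to have no f-component and make its g-component a function
of Xf, so the compression and Xf recover X. -/
theorem expand_compress (h : IsHyperbolicPair ω (-1) g f) (hω : ω.IsAlt) {X : Module.End F V}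
    (hX : ∀ x, ω (X x) x = 0) (hg : X g = 0) : expand h (h.compress X) (X f) = X := by
  ext w
  have e1 : ω g (X w) = 0 := by rw [← apply_eq_apply_of_alt hω hX, hg]; simp
  have e2 := mem_hyperbolicComplement.1 (apply_right_mem (f := f) hω hX hg)
  have e3 : h.proj (X f) = X f := h.proj_eq_self (apply_right_mem hω hX hg)
  have e4 : ω (X w) f = ω w (X f) := apply_eq_apply_of_alt hω hX w f
  have e5 := hω.neg_eq (X w) f
  have e6 := hω.neg_eq g w
  rw [expand_apply]
  simp only [IsHyperbolicPair.compress, LinearMap.comp_apply, Submodule.subtype_apply,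
    h.coe_projTo]
  rw [h.proj_apply w]
  simp only [map_sub, map_smul, hg, e3, smul_zero, sub_zero]
  rw [h.proj_apply (X w), e1, ← e5, ← e4, ← e6]
  simp only [zero_smul, sub_zero, neg_mul, one_mul, neg_neg, neg_smul, sub_neg_eq_add]
  abel

theorem compress_alt (h : IsHyperbolicPair ω (-1) g f) {X : Module.End F V}
    (hX : ∀ x, ω (X x) x = 0) (x : hyperbolicComplement ω g f) :
    ω.restrict (hyperbolicComplement ω g f) (h.compress X x) x = 0 := by
  have e1 := mem_hyperbolicComplement.1 x.2
  simp [IsHyperbolicPair.compress, h.proj_apply, e1, hX]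

/-- An element of `nilAlt ω` killing `g` is determined by its compression, an element of `nilAlt`,
and by an arbitrary vector, the image of `f`. -/
def nilAltKillEquiv (h : IsHyperbolicPair ω (-1) g f) (hω : ω.IsAlt) :
    {X : Module.End F V // X ∈ nilAlt ω ∧ X g = 0} ≃
      nilAlt (ω.restrict (hyperbolicComplement ω g f)) × hyperbolicComplement ω g f where
  toFun X := (⟨h.compress X, (h.isNilpotent_compress_iff (mul_proj_mul h hω X.2.1.2 X.2.2)).2
    X.2.1.1, compress_alt h X.2.1.2⟩, ⟨X.1 f, apply_right_mem hω X.2.1.2 X.2.2⟩)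
  invFun p := ⟨expand h p.1 p.2, ⟨by
      rw [← h.isNilpotent_compress_iff (mul_proj_mul h hω (expand_alt h hω p.1.2.2 p.2)
        (expand_left h _ p.2.2)), compress_expand]
      exact p.1.2.1, expand_alt h hω p.1.2.2 p.2⟩, expand_left h _ p.2.2⟩
  left_inv X := Subtype.ext (expand_compress h hω X.2.1.2 X.2.2)
  right_inv p := Prod.ext (Subtype.ext (compress_expand h _ _))
    (Subtype.ext (expand_right h _ p.2.2))

end Reduction

end SymmetricSpace

/-! ### Prescribed chains that end in 0 -/

namespace SymmetricSpace

open Module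

section Chain

variable {F V : Type*} [Field F] [AddCommGroup V] [Module F V]

/-- A linearly independent, totally isotropic family `e 0, …, e (d - 1)`. -/
structure IsIsotropicFamily (ω : LinearMap.BilinForm F V) (e : ℕ → V) (d : ℕ) : Prop where
  indep : LinearIndependent F fun i : Fin d => e i
  isotropic : ∀ i < d, ∀ j < d, ω (e i) (e j) = 0

theorem exists_apply_eq_of_linearIndependent [FiniteDimensional F V]
    {ω : LinearMap.BilinForm F V} (hω : ω.IsAlt) (hn : ω.Nondegenerate) {d : ℕ} {e : Fin d → V}
    (he : LinearIndependent F e) (c : Fin d → F) : ∃ u, ∀ i, ω (e i) u = c i := by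
  obtain ⟨φ, hφ⟩ := LinearMap.exists_extend ((Basis.span he).constr F c)
  -- The sign appears because `toDual` puts u in the first argument of ω.
  refine ⟨-((ω.toDual hn).symm φ), fun i => ?_⟩
  rw [map_neg, hω.neg_eq, ← LinearMap.BilinForm.toDual_def hn, LinearEquiv.apply_symm_apply]
  have h1 := LinearMap.congr_fun hφ (Basis.span he i)
  rw [Basis.constr_basis] at h1
  simpa [Basis.span_apply] using h1

theorem natCard_fiber_mul {A B : Type*} [AddCommGroup A] [AddCommGroup B] (f : A →+ B)
    (hf : Function.Surjective f) (b : B) : Nat.card {a // f a = b} * Nat.card B = Nat.card A := by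
  obtain ⟨a₀, rfl⟩ := hf b
  have h1 : Nat.card {a // f a = f a₀} = Nat.card f.ker := Nat.card_congr
    { toFun := fun a => ⟨a.1 - a₀, by rw [AddMonoidHom.mem_ker, map_sub, a.2, sub_self]⟩
      invFun := fun a => ⟨a.1 + a₀, by rw [map_add, a.2, zero_add]⟩
      left_inv := fun a => by simp
      right_inv := fun a => by simp }
  rw [h1, ← Nat.card_congr (QuotientAddGroup.quotientKerEquivOfSurjective f hf).toEquiv,
    AddSubgroup.card_eq_card_quotient_mul_card_addSubgroup f.ker, mul_comm]

/-- Take f dual to the last vector e_d and orthogonal to the earlier ones. As X kills e_d, it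
amounts to its compression together with Xf ∈ V'. The chain condition becomes a chain condition of
length d on the compression and d independent linear equations on Xf, whence the factor q^d on the
left. -/
theorem exists_chain_reduction [Finite F] [FiniteDimensional F V] {ω : LinearMap.BilinForm F V}
    (hω : ω.IsAlt) (hn : ω.Nondegenerate) {d : ℕ} {e : ℕ → V}
    (he : IsIsotropicFamily ω e (d + 1)) (hlast : e (d + 1) = 0) :
    ∃ (V' : Submodule F V) (e' : ℕ → V'), finrank F V = finrank F V' + 2 ∧
      (ω.restrict V').Nondegenerate ∧ IsIsotropicFamily (ω.restrict V') e' d ∧ e' d = 0 ∧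
      Nat.card (nilAltChain ω e (d + 1)) * Nat.card F ^ d =
        Nat.card (nilAltChain (ω.restrict V') e' d) * Nat.card F ^ finrank F V' := by
  obtain ⟨f, hf⟩ := exists_apply_eq_of_linearIndependent hω hn he.indep
    (fun i => if (i : ℕ) = d then 1 else 0)
  have hf1 : ω (e d) f = 1 := by simpa using hf (Fin.last d)
  have hf0 : ∀ i < d, ω (e i) f = 0 := fun i hi => by
    simpa [hi.ne] using hf ⟨i, by omega⟩
  have h := isHyperbolicPair_of_isAlt hω hf1
  have hmem : ∀ i < d, e i ∈ hyperbolicComplement ω (e d) f := fun i hi => by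
    rw [mem_hyperbolicComplement, he.isotropic d (by omega) i (by omega), ← hω.neg_eq, hf0 i hi]
    simp
  have hp : ∀ i < d, h.proj (e i) = e i := fun i hi => h.proj_eq_self (hmem i hi)
  have hd : h.projTo (e d) = 0 := Subtype.ext h.proj_left
  set V' := hyperbolicComplement ω (e d) f with hV'
  have hli : LinearIndependent F fun i : Fin d => h.projTo (e i) := by
    refine LinearIndependent.of_comp V'.subtype ?_
    have h1 := he.indep.comp (Fin.castSucc : Fin d → Fin (d + 1)) (Fin.castSucc_injective d)
    convert h1 using 1
    ext i
    exact hp i i.2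
  refine ⟨V', fun i => h.projTo (e i), h.finrank_eq, h.restrict_nondegenerate hn,
    ⟨hli, fun i hi j hj => ?_⟩, hd, ?_⟩
  · have := he.isotropic i (by omega) j (by omega)
    simpa [hp i hi, hp j hj] using this
  let Φ : V' →ₗ[F] (Fin d → F) := LinearMap.pi fun i => (ω (e i)) ∘ₗ V'.subtype
  have hΦ : Function.Surjective Φ := by
    intro c
    have hω' : (ω.restrict V').IsAlt := fun x => hω x
    obtain ⟨u, hu⟩ := exists_apply_eq_of_linearIndependent hω' (h.restrict_nondegenerate hn) hli c
    refine ⟨u, funext fun i => ?_⟩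
    rw [← hu i]
    exact congrArg (fun z => ω z u) (hp i i.2).symm
  have hfib := natCard_fiber_mul Φ.toAddMonoidHom hΦ (fun i => ω (e (i + 1)) f)
  -- Modulo the plane this is the compressed chain. The f-coordinates of X e_i and e_(i+1) both
  -- vanish, and equality of the e_d-coordinates is the equation on Xf.
  have hchain : ∀ X : {X : Module.End F V // X ∈ nilAlt ω ∧ X (e d) = 0},
      (∀ i < d, X.1 (e i) = e (i + 1)) ↔
      (∀ i < d, h.compress X.1 (h.projTo (e i)) = h.projTo (e (i + 1))) ∧
        Φ ⟨X.1 f, apply_right_mem hω X.2.1.2 X.2.2⟩ = fun i : Fin d => ω (e (i + 1)) f := by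
    rintro ⟨X, ⟨-, hX⟩, hg⟩
    constructor
    · intro hc
      refine ⟨fun i hi => Subtype.ext ?_, funext fun i => ?_⟩
      · simp [IsHyperbolicPair.compress, hp i hi, hc i hi]
      · have := apply_eq_apply_of_alt hω hX (e i) f
        rw [hc i i.2] at this
        exact this.symm
    · rintro ⟨h1, h2⟩ i hi
      have h3 : ω (e i) (X f) = ω (e (i + 1)) f := congrFun h2 ⟨i, hi⟩
      have h4 := congrArg Subtype.val (h1 i hi)
      have h5 : h.proj (X (e i)) = h.proj (e (i + 1)) := by
        simpa [IsHyperbolicPair.compress, hp i hi] using h4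
      have h6 : ω (e d) (X (e i)) = 0 := by
        rw [← apply_eq_apply_of_alt hω hX, hg]; simp
      rw [h.eq_add_proj (X (e i)), h.eq_add_proj (e (i + 1)), h5, h6,
        he.isotropic d (by omega) (i + 1) (by omega), ← hω.neg_eq (X (e i)),
        apply_eq_apply_of_alt hω hX, h3, hω.neg_eq]
  let E : nilAltChain ω e (d + 1) ≃
      nilAltChain (ω.restrict V') (fun i => h.projTo (e i)) d ×
        {u : V' // Φ u = fun i : Fin d => ω (e (i + 1)) f} :=
    { toFun := fun X =>
        have hX : X.1 ∈ nilAlt ω ∧ X.1 (e d) = 0 := ⟨X.2.1, by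
          rw [X.2.2 d (by omega), hlast]⟩
        have hc := (hchain ⟨X.1, hX⟩).1 fun i hi => X.2.2 i (by omega)
        (⟨h.compress X.1, (nilAltKillEquiv h hω ⟨X.1, hX⟩).1.2, hc.1⟩, ⟨_, hc.2⟩)
      invFun := fun p =>
        let X := (nilAltKillEquiv h hω).symm (⟨p.1.1, p.1.2.1⟩, p.2.1)
        ⟨X.1, X.2.1, fun i hi => by
          obtain rfl | hi' := eq_or_lt_of_le (Nat.lt_succ_iff.1 hi)
          · rw [hlast, X.2.2]
          · have h1 : nilAltKillEquiv h hω X = (⟨p.1.1, p.1.2.1⟩, p.2.1) :=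
              Equiv.apply_symm_apply _ _
            refine (hchain X).2 ⟨?_, ?_⟩ i hi'
            · rw [show h.compress X.1 = p.1.1 from congrArg (fun z => z.1.1) h1]
              exact p.1.2.2
            · rw [← p.2.2]
              exact congrArg (fun z => Φ z.2) h1⟩
      left_inv := fun X => Subtype.ext (expand_compress h hω X.2.1.2 (by
        rw [X.2.2 d (by omega), hlast]))
      right_inv := fun p => by
        have h1 := (nilAltKillEquiv h hω).apply_symm_apply (⟨p.1.1, p.1.2.1⟩, p.2.1)
        exact Prod.ext (Subtype.ext (congrArg (fun z => z.1.1) h1))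
          (Subtype.ext (congrArg (fun z => z.2) h1)) }
  rw [Nat.card_congr E, Nat.card_prod, mul_assoc, ← Module.natCard_eq_pow_finrank (K := F) (V := V'),
    ← hfib]
  congr 2
  simp [Nat.card_fun]

end Chain

section Count

universe u v

variable {F : Type u} [Field F] [Finite F]

/-- Each reduction removes one chain vector and two dimensions; after d of them there is no chain
left and the count in dimension 2m applies. -/
theorem natCard_chain_kill (m : ℕ)
    (hm : ∀ (W : Type v) [AddCommGroup W] [Module F W] [FiniteDimensional F W]
      (ω : LinearMap.BilinForm F W), finrank F W = 2 * m → ω.IsAlt → ω.Nondegenerate →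
      Nat.card (nilAlt ω) = Nat.card F ^ (4 * m.choose 2))
    (d : ℕ) : ∀ {V : Type v} [AddCommGroup V] [Module F V] [FiniteDimensional F V]
    {ω : LinearMap.BilinForm F V} (_ : finrank F V = 2 * (m + d)) (_ : ω.IsAlt)
    (_ : ω.Nondegenerate) {e : ℕ → V} (_ : IsIsotropicFamily ω e d) (_ : e d = 0),
    Nat.card (nilAltChain ω e d) =
      Nat.card F ^ (4 * m.choose 2 + 2 * d * m + d.choose 2) := by
  induction d with
  | zero =>
    intro V _ _ _ ω hV hω hn e he hlast
    rw [show nilAltChain ω e 0 = nilAlt ω by ext; simp [nilAltChain], hm V ω hV hω hn]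
    simp
  | succ d ih =>
    intro V _ _ _ ω hV hω hn e he hlast
    obtain ⟨V', e', h1, h2, h3, h4, h5⟩ := exists_chain_reduction hω hn he hlast
    have hω' : (ω.restrict V').IsAlt := fun x => hω x
    rw [ih (by omega) hω' h2 h3 h4, show finrank F V' = 2 * (m + d) by omega] at h5
    have hpos : 0 < Nat.card F ^ d := pow_pos Nat.card_pos _
    refine Nat.eq_of_mul_eq_mul_right hpos (h5.trans ?_)
    rw [← pow_add, ← pow_add, Nat.choose_succ_succ' d 1, Nat.choose_one_right]
    congr 1
    ring

end Count

end SymmetricSpace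

/-! ### Extending a chain by one vector -/

namespace SymmetricSpace

open Module

section Extend

variable {F V : Type*} [Field F] [AddCommGroup V] [Module F V]

/-- The span of the first `d` members of a family. -/
def chainSpan (F : Type*) {V : Type*} [Field F] [AddCommGroup V] [Module F V] (e : ℕ → V) (d : ℕ) :
    Submodule F V :=
  Submodule.span F (Set.range fun i : Fin d => e i)

theorem mem_chainSpan {e : ℕ → V} {d i : ℕ} (hi : i < d) : e i ∈ chainSpan F e d :=
  Submodule.subset_span ⟨⟨i, hi⟩, rfl⟩

theorem chainSpan_le {e : ℕ → V} {d : ℕ} {W : Submodule F V} (h : ∀ i < d, e i ∈ W) :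
    chainSpan F e d ≤ W :=
  Submodule.span_le.2 (by rintro _ ⟨i, rfl⟩; exact h i i.2)

theorem IsIsotropicFamily.update_of_le {ω : LinearMap.BilinForm F V} {e : ℕ → V} {d n : ℕ}
    (he : IsIsotropicFamily ω e d) (hn : d ≤ n) (w : V) :
    IsIsotropicFamily ω (Function.update e n w) d := by
  constructor
  · convert he.indep using 2 with i
    rw [Function.update_of_ne (by omega)]
  · intro i hi j hj
    rw [Function.update_of_ne (by omega), Function.update_of_ne (by omega),
      he.isotropic i hi j hj]

theorem IsIsotropicFamily.finrank_chainSpan {ω : LinearMap.BilinForm F V} {e : ℕ → V} {d : ℕ}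
    (he : IsIsotropicFamily ω e d) : finrank F (chainSpan F e d) = d := by
  rw [chainSpan, finrank_span_eq_card he.indep, Fintype.card_fin]

theorem mem_orthogonal_chainSpan {ω : LinearMap.BilinForm F V} {e : ℕ → V} {d : ℕ} {w : V} :
    w ∈ ω.orthogonal (chainSpan F e d) ↔ ∀ i < d, ω (e i) w = 0 := by
  constructor
  · intro h i hi
    exact LinearMap.BilinForm.mem_orthogonal_iff.1 h _ (mem_chainSpan hi)
  · intro h
    rw [LinearMap.BilinForm.mem_orthogonal_iff]
    intro y hy
    have : chainSpan F e d ≤ LinearMap.ker (ω.flip w) := chainSpan_le fun i hi => h i hi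
    exact this hy

theorem IsIsotropicFamily.chainSpan_le_orthogonal {ω : LinearMap.BilinForm F V} {e : ℕ → V}
    {d : ℕ} (he : IsIsotropicFamily ω e d) :
    chainSpan F e d ≤ ω.orthogonal (chainSpan F e d) :=
  chainSpan_le fun j hj => mem_orthogonal_chainSpan.2 fun i hi => he.isotropic i hi j hj

theorem IsIsotropicFamily.update {ω : LinearMap.BilinForm F V} (hω : ω.IsAlt) {e : ℕ → V} {d : ℕ}
    (he : IsIsotropicFamily ω e d) {w : V} (hw : w ∈ ω.orthogonal (chainSpan F e d))
    (hw' : w ∉ chainSpan F e d) : IsIsotropicFamily ω (Function.update e d w) (d + 1) := by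
  rw [mem_orthogonal_chainSpan] at hw
  constructor
  · rw [linearIndependent_finSucc']
    have h1 : (Fin.init fun i : Fin (d + 1) => Function.update e d w i) =
        fun i : Fin d => e i := by
      ext i
      simp [Fin.init, i.2.ne]
    rw [h1]
    refine ⟨he.indep, ?_⟩
    change Function.update e d w d ∉ _
    rwa [Function.update_self]
  · intro i hi j hj
    rcases eq_or_ne i d with rfl | hi' <;> rcases eq_or_ne j i with rfl | hj'
    · exact hω _
    · rw [Function.update_self, Function.update_of_ne hj', ← hω.neg_eq, hw j (by omega), neg_zero]
    · exact hω _
    · rw [Function.update_of_ne hi']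
      rcases eq_or_ne j d with rfl | hj''
      · rw [Function.update_self, hw i (by omega)]
      · rw [Function.update_of_ne hj'', he.isotropic i (by omega) j (by omega)]

theorem pow_apply_of_chain {e : ℕ → V} {d : ℕ} {X : Module.End F V}
    (hX : ∀ i < d, X (e i) = e (i + 1)) : ∀ i ≤ d, (X ^ i) (e 0) = e i := by
  intro i hi
  induction i with
  | zero => rfl
  | succ i ih => rw [pow_succ', Module.End.mul_apply, ih (by omega), hX i (by omega)]

theorem chain_next_mem_orthogonal {ω : LinearMap.BilinForm F V} (hω : ω.IsAlt) {e : ℕ → V} {d : ℕ}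
    {X : Module.End F V} (hX : X ∈ nilAltChain ω e d) : e d ∈ ω.orthogonal (chainSpan F e d) := by
  rw [mem_orthogonal_chainSpan]
  intro i hi
  rw [← pow_apply_of_chain hX.2 i hi.le, ← pow_apply_of_chain hX.2 d le_rfl]
  exact apply_pow_eq_zero hω hX.1.2 _ _ _

/-- If e_d falls back into the span, the span is X-invariant of dimension d, so by nilpotency X^d
vanishes on it, and e_d = X^d e_0. -/
theorem chain_next_eq_zero [FiniteDimensional F V] {ω : LinearMap.BilinForm F V} {e : ℕ → V}
    {d : ℕ} (hd : d ≠ 0) (he : IsIsotropicFamily ω e d) {X : Module.End F V}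
    (hX : X ∈ nilAltChain ω e d) (h : e d ∈ chainSpan F e d) : e d = 0 := by
  have hinv : ∀ w ∈ chainSpan F e d, X w ∈ chainSpan F e d := by
    have : chainSpan F e d ≤ (chainSpan F e d).comap X := chainSpan_le fun i hi => by
      rw [Submodule.mem_comap, hX.2 i hi]
      rcases eq_or_ne (i + 1) d with h' | h'
      · rwa [h']
      · exact mem_chainSpan (by omega)
    exact this
  have hnil : IsNilpotent (X.restrict hinv) := by
    obtain ⟨n, hn⟩ := hX.1.1
    refine ⟨n, ?_⟩
    rw [Module.End.pow_restrict]
    ext w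
    simp [hn, LinearMap.restrict_apply]
  have h1 := (X.restrict hinv).aeval_self_charpoly
  rw [(LinearMap.isNilpotent_iff_charpoly _).1 hnil, he.finrank_chainSpan, map_pow,
    Polynomial.aeval_X, Module.End.pow_restrict] at h1
  have h2 := congrArg Subtype.val
    (LinearMap.congr_fun h1 ⟨e 0, mem_chainSpan (Nat.pos_of_ne_zero hd)⟩)
  rw [← pow_apply_of_chain hX.2 d le_rfl]
  exact h2

/-- Sort the X by w = X e_d: only w = 0 or w ∈ W^⊥ \ W can occur, where W is the span of e_0, …,
e_d. The term for W is moved to the left to avoid subtraction. -/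
theorem natCard_chain_step [Finite F] [FiniteDimensional F V] {ω : LinearMap.BilinForm F V}
    (hω : ω.IsAlt) (hn : ω.Nondegenerate) {d : ℕ} {e : ℕ → V}
    (he : IsIsotropicFamily ω e (d + 1)) (c : ℕ)
    (hc : ∀ w ∈ ω.orthogonal (chainSpan F e (d + 1)), w ∉ chainSpan F e (d + 1) →
      Nat.card (nilAltChain ω (Function.update e (d + 1) w) (d + 1)) = c) :
    Nat.card (nilAltChain ω e d) + Nat.card F ^ (d + 1) * c =
      Nat.card (nilAltChain ω (Function.update e (d + 1) 0) (d + 1)) +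
        Nat.card F ^ (finrank F V - (d + 1)) * c := by
  classical
  have : Finite V := Module.finite_of_finite F
  have := Fintype.ofFinite V
  have : Finite (Module.End F V) :=
    Finite.of_injective (fun X : Module.End F V => (X : V → V)) DFunLike.coe_injective
  set W := chainSpan F e (d + 1)
  have hWO : W ≤ ω.orthogonal W := he.chainSpan_le_orthogonal
  let E : nilAltChain ω e d ≃ Σ w : V, nilAltChain ω (Function.update e (d + 1) w) (d + 1) :=
    { toFun := fun X => ⟨X.1 (e d), X.1, X.2.1, fun i hi => by
        rw [Function.update_of_ne (by omega)]
        rcases eq_or_ne i d with rfl | hi'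
        · rw [Function.update_self]
        · rw [Function.update_of_ne (by omega), X.2.2 i (by omega)]⟩
      invFun := fun X => ⟨X.2.1, X.2.2.1, fun i hi => by
        have := X.2.2.2 i (by omega)
        rwa [Function.update_of_ne (by omega), Function.update_of_ne (by omega)] at this⟩
      left_inv := fun X => rfl
      right_inv := by
        rintro ⟨w, X, hX⟩
        have h1 := hX.2 d (by omega)
        rw [Function.update_of_ne (by omega), Function.update_self] at h1
        subst h1
        rfl }
  have hterm : ∀ w : V, Nat.card (nilAltChain ω (Function.update e (d + 1) w) (d + 1)) =
      (if w = 0 then Nat.card (nilAltChain ω (Function.update e (d + 1) 0) (d + 1)) else 0) +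
      (if w ∈ ω.orthogonal W ∧ w ∉ W then c else 0) := by
    intro w
    by_cases hw0 : w = 0
    · subst hw0
      simp [W.zero_mem]
    by_cases hw : w ∈ ω.orthogonal W ∧ w ∉ W
    · rw [if_neg hw0, if_pos hw, hc w hw.1 hw.2, zero_add]
    · rw [if_neg hw0, if_neg hw, Nat.card_eq_zero]
      refine Or.inl ⟨fun X => hw ?_⟩
      have hspan : chainSpan F (Function.update e (d + 1) w) (d + 1) = W := by
        unfold W chainSpan
        congr 2
        ext i
        rw [Function.update_of_ne i.2.ne]
      have hfam := he.update_of_le le_rfl w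
      have h1 := chain_next_mem_orthogonal hω X.2
      have h2 := chain_next_eq_zero (by omega) hfam X.2
      rw [hspan, Function.update_self] at h1 h2
      exact ⟨h1, fun h => hw0 (h2 h)⟩
  have hfilter : (Finset.univ.filter fun w => w ∈ ω.orthogonal W ∧ w ∉ W).card +
      Nat.card F ^ (d + 1) = Nat.card F ^ (finrank F V - (d + 1)) := by
    rw [← he.finrank_chainSpan, ← LinearMap.BilinForm.finrank_orthogonal hn,
      ← Module.natCard_eq_pow_finrank (K := F), ← Module.natCard_eq_pow_finrank (K := F),
      Nat.card_eq_fintype_card, Nat.card_eq_fintype_card, Fintype.card_subtype,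
      Fintype.card_subtype, ← Finset.card_union_of_disjoint]
    · congr 1
      ext w
      simp only [Finset.mem_union, Finset.mem_filter, Finset.mem_univ, true_and]
      constructor
      · rintro (h | h)
        · exact h.1
        · exact hWO h
      · intro h
        by_cases h' : w ∈ W
        · exact Or.inr h'
        · exact Or.inl ⟨h, h'⟩
    · rw [Finset.disjoint_filter]
      exact fun w _ h h' => h.2 h'
  rw [Nat.card_congr E, Nat.card_sigma, Finset.sum_congr rfl fun w _ => hterm w,
    Finset.sum_add_distrib, Finset.sum_ite_eq' Finset.univ (0 : V), if_pos (Finset.mem_univ _),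
    ← Finset.sum_filter, Finset.sum_const, smul_eq_mul, add_assoc, ← add_mul, hfilter]

end Extend

/-! ### The number of self-adjoint nilpotents -/

section Count

universe u v

variable {F : Type u} [Field F] [Finite F]

theorem natCard_chain (m : ℕ)
    (hm : ∀ m' ≤ m, ∀ (W : Type v) [AddCommGroup W] [Module F W] [FiniteDimensional F W]
      (ω : LinearMap.BilinForm F W), finrank F W = 2 * m' → ω.IsAlt → ω.Nondegenerate →
      Nat.card (nilAlt ω) = Nat.card F ^ (4 * m'.choose 2))
    (d : ℕ) {V : Type v} [AddCommGroup V] [Module F V] [FiniteDimensional F V]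
    {ω : LinearMap.BilinForm F V} (hV : finrank F V = 2 * (m + (d + 1))) (hω : ω.IsAlt)
    (hn : ω.Nondegenerate) {e : ℕ → V} (he : IsIsotropicFamily ω e (d + 1)) :
    Nat.card (nilAltChain ω e d) =
      Nat.card F ^ (4 * m.choose 2 + 2 * (d + 1) * m + (d + 1).choose 2 + 2 * m) := by
  have hkill := natCard_chain_kill m (hm m le_rfl) (d + 1) hV hω hn (he.update_of_le le_rfl 0)
    (Function.update_self ..)
  induction m generalizing d e with
  | zero =>
    -- For m = 0 the span is Lagrangian, so W^⊥ \ W is empty and the chain must stop; the value 0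
    -- for c is vacuous.
    have h1 := natCard_chain_step hω hn he 0 (fun w hw hw' => by
      have h2 : chainSpan F e (d + 1) = ω.orthogonal (chainSpan F e (d + 1)) :=
        Submodule.eq_of_le_of_finrank_eq he.chainSpan_le_orthogonal (by
          rw [LinearMap.BilinForm.finrank_orthogonal hn, he.finrank_chainSpan, hV]
          omega)
      exact absurd (h2 ▸ hw) hw')
    rw [hkill] at h1
    simpa using h1
  | succ m ih =>
    have h1 := natCard_chain_step hω hn he
      (Nat.card F ^ (4 * m.choose 2 + 2 * (d + 1 + 1) * m + (d + 1 + 1).choose 2 + 2 * m))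
      (fun w hw hw' => by
        have he' := he.update hω hw hw'
        exact ih (fun m' hm' => hm m' (by omega)) (d + 1) (by omega) he'
          (natCard_chain_kill m (hm m (by omega)) (d + 1 + 1) (by omega) hω hn
            (he'.update_of_le le_rfl 0) (Function.update_self ..)))
    rw [hkill, hV] at h1
    have h2 : 2 * (m + 1 + (d + 1)) - (d + 1) = 2 * m + d + 3 := by omega
    rw [h2, Nat.choose_succ_succ' m 1, Nat.choose_succ_succ' (d + 1) 1, Nat.choose_one_right,
      Nat.choose_one_right] at h1
    rw [Nat.choose_succ_succ' m 1, Nat.choose_one_right]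
    generalize m.choose 2 = a at h1 ⊢
    generalize (d + 1).choose 2 = b at h1 ⊢
    generalize Nat.card F = q at h1 ⊢
    -- The key cancellation: |W| times the count for one continuation equals the count of the X that
    -- kill the last vector.
    have h3 : q ^ (d + 1) * q ^ (4 * a + 2 * (d + 1 + 1) * m + (d + 1 + b) + 2 * m) =
        q ^ (4 * (m + a) + 2 * (d + 1) * (m + 1) + b) := by
      rw [← pow_add]
      congr 1
      ring
    rw [h3, add_comm] at h1
    rw [Nat.add_left_cancel h1, ← pow_add]
    congr 1
    ring

theorem natCard_nilAlt (n : ℕ) : ∀ (V : Type v) [AddCommGroup V] [Module F V]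
    [FiniteDimensional F V] (ω : LinearMap.BilinForm F V), finrank F V = 2 * n → ω.IsAlt →
    ω.Nondegenerate → Nat.card (nilAlt ω) = Nat.card F ^ (4 * n.choose 2) := by
  induction n using Nat.strong_induction_on with
  | _ n ih =>
    intro V _ _ _ ω hV hω hn
    rcases n with _ | n
    · have := finrank_zero_iff.1 hV
      have h1 : nilAlt ω = Set.univ := Set.eq_univ_of_forall fun X =>
        ⟨⟨1, Subsingleton.elim _ _⟩, fun x => by rw [Subsingleton.elim x 0]; simp⟩
      rw [h1]
      have : Unique (Module.End F V) := ⟨⟨0⟩, fun _ => Subsingleton.elim _ _⟩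
      simp
    · have : Nontrivial V := Module.nontrivial_of_finrank_pos (R := F) (by omega)
      obtain ⟨v, hv⟩ := exists_ne (0 : V)
      -- A one-vector chain imposes no condition on X, so the chain count with d = 0 is the full
      -- count.
      have he : IsIsotropicFamily ω (fun _ => v) (0 + 1) :=
        ⟨by simpa [linearIndependent_unique_iff] using hv, fun _ _ _ _ => hω v⟩
      have h1 := natCard_chain n (fun m' hm' => ih m' (by omega)) 0 (by omega) hω hn he
      rw [show nilAltChain ω (fun _ => v) 0 = nilAlt ω by ext; simp [nilAltChain]] at h1
      rw [h1, Nat.choose_succ_succ' n 1, Nat.choose_one_right]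
      congr 1
      simp
      ring

end Count

end SymmetricSpace

/-! ### Polynomial functions and Zariski closure -/

namespace SymmetricSpace

open Module

section Closure

variable {k M : Type*} [Field k] [AddCommGroup M] [Module k M]

theorem dual_mem_polynomialFunctions (φ : Module.Dual k M) :
    (φ : M → k) ∈ polynomialFunctions k M :=
  Algebra.subset_adjoin ⟨φ, rfl⟩

theorem exists_polynomial_on_line {f : M → k} (hf : f ∈ polynomialFunctions k M) (x y : M) :
    ∃ p : Polynomial k, ∀ t : k, f (x + t • y) = p.eval t := by
  induction hf using Algebra.adjoin_induction with
  | mem f hf =>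
    obtain ⟨φ, rfl⟩ := hf
    exact ⟨Polynomial.C (φ x) + Polynomial.X * Polynomial.C (φ y), fun t => by simp; ring⟩
  | algebraMap c => exact ⟨Polynomial.C c, fun t => by simp⟩
  | add f g _ _ hf hg =>
    obtain ⟨p, hp⟩ := hf
    obtain ⟨r, hr⟩ := hg
    exact ⟨p + r, fun t => by simp [hp, hr]⟩
  | mul f g _ _ hf hg =>
    obtain ⟨p, hp⟩ := hf
    obtain ⟨r, hr⟩ := hg
    exact ⟨p * r, fun t => by simp [hp, hr]⟩

theorem subset_zariskiClosure (S : Set M) : S ⊆ zariskiClosure k S :=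
  fun _ hx _ _ hS => hS _ hx

theorem zariskiClosure_subset {S T : Set M} (h : S ⊆ zariskiClosure k T) :
    zariskiClosure k S ⊆ zariskiClosure k T :=
  fun _ hx f hf hT => hx f hf fun _ hy => h hy f hf hT

/-- A polynomial function vanishing on S restricts to a polynomial p(t) on the line that is zero for
t ≠ 0. Then t·p(t) vanishes on an infinite field, so p = 0, including at t = 0. -/
theorem mem_zariskiClosure_of_line [Infinite k] {S : Set M} {x y : M}
    (h : ∀ t : k, t ≠ 0 → x + t • y ∈ S) : x ∈ zariskiClosure k S := by
  intro f hf hS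
  obtain ⟨p, hp⟩ := exists_polynomial_on_line hf x y
  have h1 : Polynomial.X * p = 0 := Polynomial.funext fun t => by
    rcases eq_or_ne t 0 with rfl | ht
    · simp
    · simp [← hp t, hS _ (h t ht)]
  have h2 : p = 0 := (mul_eq_zero.1 h1).resolve_left Polynomial.X_ne_zero
  have h3 := hp 0
  rwa [h2, zero_smul, add_zero, Polynomial.eval_zero] at h3

theorem det_mem_polynomialFunctions {W : Type*} [AddCommGroup W] [Module k W]
    [FiniteDimensional k W] (L : M →ₗ[k] Module.End k W) (A : Module.End k W) :
    (fun x => LinearMap.det (A + L x)) ∈ polynomialFunctions k M := by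
  classical
  let b := Module.finBasis k W
  have h1 : (fun x => LinearMap.det (A + L x)) =
      ∑ σ : Equiv.Perm (Fin (finrank k W)), ((Equiv.Perm.sign σ : ℤ) : M → k) *
        ∏ i, fun x => LinearMap.toMatrix b b (A + L x) (σ i) i := by
    ext x
    rw [← LinearMap.det_toMatrix b, Matrix.det_apply']
    simp [Finset.sum_apply, Finset.prod_apply]
  rw [h1]
  refine Subalgebra.sum_mem _ fun σ _ => Subalgebra.mul_mem _ (intCast_mem _ _)
    (Subalgebra.prod_mem _ fun i _ => ?_)
  have h2 : (fun x => LinearMap.toMatrix b b (A + L x) (σ i) i) =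
      algebraMap k (M → k) (LinearMap.toMatrix b b A (σ i) i) +
        ((b.coord (σ i) ∘ₗ LinearMap.applyₗ (b i) ∘ₗ L : Module.Dual k M) : M → k) := by
    ext x
    simp [LinearMap.toMatrix_apply]
  rw [h2]
  exact Subalgebra.add_mem _ (Subalgebra.algebraMap_mem _ _) (dual_mem_polynomialFunctions _)

theorem bilin_self_mem_polynomialFunctions {W : Type*} [AddCommGroup W] [Module k W]
    [FiniteDimensional k W] (B : LinearMap.BilinForm k W) (L : M →ₗ[k] W) :
    (fun x => B (L x) (L x)) ∈ polynomialFunctions k M := by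
  let b := Module.finBasis k W
  have h1 : (fun x => B (L x) (L x)) = ∑ i, ((b.coord i ∘ₗ L : Module.Dual k M) : M → k) *
      ((B (b i) ∘ₗ L : Module.Dual k M) : M → k) := by
    ext x
    have h2 : ∀ w : W, B w (L x) = ∑ i, b.repr w i * B (b i) (L x) := by
      intro w
      conv_lhs => rw [← b.sum_repr w]
      simp only [map_sum, map_smul, LinearMap.sum_apply, LinearMap.smul_apply, smul_eq_mul]
    simp [Finset.sum_apply, ← h2]
  rw [h1]
  exact Subalgebra.sum_mem _ fun i _ => Subalgebra.mul_mem _ (dual_mem_polynomialFunctions _)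
    (dual_mem_polynomialFunctions _)

end Closure

/-! ### The one-parameter torus of a hyperbolic pair -/

section Torus

variable {k W : Type*} [Field k] [AddCommGroup W] [Module k W]
  {B : LinearMap.BilinForm k W} {ε : k} {e f : W}

namespace IsHyperbolicPair

/-- The isometry scaling `e` by `t`, scaling `f` by `t⁻¹`, and fixing the orthogonal complement. -/
def torus (h : IsHyperbolicPair B ε e f) (t : kˣ) : W ≃ₗ[k] W :=
  h.equiv ≪≫ₗ LinearEquiv.prodCongr
    (LinearEquiv.prodCongr (LinearEquiv.smulOfUnit t⁻¹) (LinearEquiv.smulOfUnit t))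
    (LinearEquiv.refl k _) ≪≫ₗ h.equiv.symm

theorem torus_apply (h : IsHyperbolicPair B ε e f) (t : kˣ) (w : W) :
    h.torus t w = ((t⁻¹ : k) * B e w) • f + (ε * (t * B f w)) • e + h.proj w := by
  rw [← Units.val_inv_eq_inv_val]
  rfl

theorem torus_left (h : IsHyperbolicPair B ε e f) (t : kˣ) : h.torus t e = (t : k) • e := by
  rw [h.torus_apply, h.left, h.pair', h.proj_left, mul_zero, zero_smul, zero_add, add_zero]
  congr 1
  linear_combination (t : k) * h.sq

theorem torus_of_mem (h : IsHyperbolicPair B ε e f) (t : kˣ) {w : W}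
    (hw : w ∈ hyperbolicComplement B e f) : h.torus t w = w := by
  have h1 := mem_hyperbolicComplement.1 hw
  simp [h.torus_apply, h1, h.proj_eq_self hw]

theorem torus_isometry (h : IsHyperbolicPair B ε e f) (t : kˣ) (x y : W) :
    B (h.torus t x) (h.torus t y) = B x y := by
  have h1 := h.orthogonal_left (h.proj_mem x)
  have h2 := mem_hyperbolicComplement.1 (h.proj_mem y)
  have ht : (t : k) * (t⁻¹ : k) = 1 := mul_inv_cancel₀ t.ne_zero
  rw [h.torus_apply, h.torus_apply]
  conv_rhs => rw [h.eq_add_proj x, h.eq_add_proj y]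
  simp only [map_add, map_smul, LinearMap.add_apply, LinearMap.smul_apply, smul_eq_mul,
    h1.1, h1.2, h2.1, h2.2, h.left, h.right, h.pair, h.pair']
  linear_combination (B e x * (ε * B f y) * ε + ε * B f x * B e y) * ht

theorem torus_mem_isometryGroup (h : IsHyperbolicPair B ε e f) (t : kˣ) :
    h.torus t ∈ isometryGroup B :=
  h.torus_isometry t

theorem det_torus [FiniteDimensional k W] (h : IsHyperbolicPair B ε e f) (t : kˣ) :
    LinearEquiv.det (h.torus t) = 1 := by
  have h1 := LinearEquiv.det_conj (LinearEquiv.prodCongr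
    (LinearEquiv.prodCongr (LinearEquiv.smulOfUnit t⁻¹) (LinearEquiv.smulOfUnit t))
    (LinearEquiv.refl k _)) h.equiv.symm
  rw [LinearEquiv.symm_symm] at h1
  rw [torus, h1]
  ext
  rw [LinearEquiv.coe_det]
  have h2 : ∀ s : kˣ, LinearMap.det
      (LinearEquiv.smulOfUnit s : k ≃ₗ[k] k).toLinearMap = (s : k) := by
    intro s
    have : (LinearEquiv.smulOfUnit s : k ≃ₗ[k] k).toLinearMap = (s : k) • LinearMap.id := by
      ext; simp [LinearEquiv.smulOfUnit, Units.smul_def]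
    rw [this, LinearMap.det_smul]
    simp
  have h3 := LinearMap.det_prodMap (LinearMap.prodMap
    (LinearEquiv.smulOfUnit t⁻¹ : k ≃ₗ[k] k).toLinearMap
    (LinearEquiv.smulOfUnit t : k ≃ₗ[k] k).toLinearMap)
    (LinearMap.id : Module.End k (hyperbolicComplement B e f))
  exact h3.trans (by
    rw [LinearMap.det_prodMap, h2, h2, LinearMap.det_id, mul_one, Units.inv_mul, Units.val_one])

end IsHyperbolicPair

theorem conj_mem_isometryLie {g : W ≃ₗ[k] W} (hg : g ∈ isometryGroup B) {X : Module.End k W}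
    (hX : X ∈ isometryLie B) : g.conj X ∈ isometryLie B := by
  intro x y
  have h1 := hX (g.symm x) (g.symm y)
  rw [← hg, ← hg (g.symm x)] at h1
  simpa [LinearEquiv.conj_apply] using h1

end Torus

/-! ### Extension of scalars -/

section BaseChange

variable {F k V : Type*} [Field F] [Field k] [Algebra F k] [AddCommGroup V] [Module F V]

theorem baseChange_swap {B : LinearMap.BilinForm F V} {ε : F} (h : ∀ x y, B y x = ε * B x y)
    (x y : k ⊗[F] V) : B.baseChange k y x = algebraMap F k ε * B.baseChange k x y := by
  induction x with
  | zero => simp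
  | add x x' hx hx' => simp only [map_add, LinearMap.add_apply, hx, hx', mul_add]
  | tmul a v =>
    induction y with
    | zero => simp
    | add y y' hy hy' => simp only [map_add, LinearMap.add_apply, hy, hy', mul_add]
    | tmul b w =>
      simp only [LinearMap.BilinForm.baseChange_tmul, Algebra.smul_def, h v w, map_mul]
      ring

theorem IsHyperbolicPair.baseChange {B : LinearMap.BilinForm F V} {ε : F} {e f : V}
    (h : IsHyperbolicPair B ε e f) :
    IsHyperbolicPair (B.baseChange k) (algebraMap F k ε) (1 ⊗ₜ e) (1 ⊗ₜ f) :=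
  ⟨by rw [← map_mul, h.sq, map_one], baseChange_swap h.swap, by simp [h.left], by simp [h.right],
    by simp [h.pair]⟩

theorem baseChange_isAlt (h2 : (2 : k) ≠ 0) {ω : LinearMap.BilinForm F V} (hω : ω.IsAlt) :
    (ω.baseChange k).IsAlt := by
  intro x
  have h1 := baseChange_swap (k := k) (B := ω) (ε := -1)
    (fun x y => by rw [neg_one_mul]; exact (hω.neg_eq x y).symm) x x
  rw [map_neg, map_one, neg_one_mul, eq_neg_iff_add_eq_zero, ← two_mul] at h1
  exact (mul_eq_zero.1 h1).resolve_left h2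

theorem baseChange_nondegenerate [FiniteDimensional F V] {B : LinearMap.BilinForm F V}
    (hB : B.Nondegenerate) : (B.baseChange k).Nondegenerate := by
  classical
  let b := Module.finBasis F V
  rw [LinearMap.BilinForm.nondegenerate_iff_det_ne_zero b] at hB
  rw [LinearMap.BilinForm.nondegenerate_iff_det_ne_zero (Algebra.TensorProduct.basis k b)]
  have h1 : LinearMap.BilinForm.toMatrix (Algebra.TensorProduct.basis k b) (B.baseChange k) =
      (algebraMap F k).mapMatrix (LinearMap.BilinForm.toMatrix b B) := by
    ext i j
    simp [LinearMap.BilinForm.toMatrix_apply, Algebra.smul_def]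
  rw [h1, ← RingHom.map_det]
  exact (map_ne_zero _).2 hB

/-- Nilpotency means that the characteristic polynomial is a power of the variable, which can be
tested after an injective coefficient extension. -/
theorem isNilpotent_baseChange_iff [FiniteDimensional F V] {X : Module.End F V} :
    IsNilpotent (X.baseChange k) ↔ IsNilpotent X := by
  rw [LinearMap.isNilpotent_iff_charpoly, LinearMap.isNilpotent_iff_charpoly,
    LinearMap.charpoly_baseChange, Module.finrank_baseChange]
  rw [← (Polynomial.map_injective _ (algebraMap F k).injective).eq_iff (a := X.charpoly)]
  simp

end BaseChange

end SymmetricSpace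

/-! ### Nilpotency in End(W) / 𝔰𝔭(W) -/

namespace SymmetricSpace

open Module

section SelfAdjoint

variable {k W : Type*} [Field k] [AddCommGroup W] [Module k W]
  {ω : LinearMap.BilinForm k W}

theorem eq_of_apply_eq (hn : ω.Nondegenerate) {X Y : Module.End k W}
    (h : ∀ x y, ω (X x) y = ω (Y x) y) : X = Y := by
  ext x
  rw [← sub_eq_zero]
  exact hn.1 _ fun y => by rw [map_sub, LinearMap.sub_apply, h, sub_self]

/-- The class of an endomorphism modulo the symplectic Lie algebra. -/
def symplecticClass (ω : LinearMap.BilinForm k W) :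
    Module.End k W →ₗ[k] LieQuotient (⊤ : Submodule k (Module.End k W)) (isometryLie ω) :=
  toLieQuotient ⊤ (isometryLie ω) ∘ₗ Submodule.topEquiv.symm.toLinearMap

theorem toLieQuotient_top (X : (⊤ : Submodule k (Module.End k W))) :
    toLieQuotient ⊤ (isometryLie ω) X = symplecticClass ω X := rfl

theorem symplecticClass_surjective (ω : LinearMap.BilinForm k W) :
    Function.Surjective (symplecticClass ω) :=
  (Submodule.mkQ_surjective _).comp Submodule.topEquiv.symm.surjective

/-- Write X as its compression plus w ↦ ω(w, Xf) e - ω(w, e) Xf. The torus fixes the compression and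
the vector Xf and scales e by t, so the second part has weight one. -/
theorem torus_conj_eq {e f : W} (h : IsHyperbolicPair ω (-1) e f) (hω : ω.IsAlt)
    {X : Module.End k W} (hX : ∀ x, ω (X x) x = 0) (he : X e = 0) (t : kˣ) :
    (h.torus t).conj X = h.proj * X * h.proj + (t : k) • (X - h.proj * X * h.proj) := by
  have hu : X f ∈ hyperbolicComplement ω e f := apply_right_mem hω hX he
  have hdec : ∀ w, X w = h.proj (X (h.proj w)) + ω w (X f) • e - ω w e • X f := by
    intro w
    conv_lhs => rw [← expand_compress h hω hX he]
    rw [expand_apply]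
    rfl
  have h1 : ∀ w, ω (h.torus t w) (X f) = ω w (X f) := fun w => by
    conv_lhs => rw [← h.torus_of_mem t hu]
    exact h.torus_isometry t _ _
  have h2 : ∀ w, (t : k) * ω (h.torus t w) e = ω w e := fun w => by
    rw [← h.torus_isometry t w e, h.torus_left, map_smul, smul_eq_mul]
  have h3 : ∀ w, h.proj (h.torus t w) = h.proj w := fun w => by
    rw [h.torus_apply]
    simp [h.proj_left, h.proj_right, h.proj_eq_self (h.proj_mem w)]
  ext w
  obtain ⟨w, rfl⟩ := (h.torus t).surjective w
  rw [LinearEquiv.conj_apply_apply, LinearEquiv.symm_apply_apply, hdec w]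
  simp only [LinearMap.add_apply, LinearMap.smul_apply, LinearMap.sub_apply, Module.End.mul_apply,
    h3, map_add, map_sub, map_smul, h.torus_left, h.torus_of_mem t hu,
    h.torus_of_mem t (h.proj_mem _)]
  rw [hdec (h.torus t w), h3, h1, ← h2]
  module

theorem exists_ker_inf_range {X : Module.End k W} (hX : IsNilpotent X) (h0 : X ≠ 0) :
    ∃ y, X y ≠ 0 ∧ X (X y) = 0 := by
  by_contra! h
  have h1 : ∀ n y, X y ≠ 0 → (X ^ n) (X y) ≠ 0 := by
    intro n
    induction n with
    | zero => exact fun y hy => hy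
    | succ n ih =>
      intro y hy
      rw [pow_succ, Module.End.mul_apply]
      exact ih _ (h y hy)
  obtain ⟨n, hn⟩ := hX
  refine h0 (LinearMap.ext fun y => ?_)
  by_contra hy
  exact h1 n y hy (by rw [hn]; rfl)

variable [FiniteDimensional k W]

/-- The sum of an endomorphism and its adjoint. -/
noncomputable def addAdjoint (hn : ω.Nondegenerate) : Module.End k W →ₗ[k] Module.End k W :=
  LinearMap.id + (ω.toDual hn).symm.conj.toLinearMap ∘ₗ Module.Dual.transpose

theorem apply_addAdjoint (hn : ω.Nondegenerate) (X : Module.End k W) (x y : W) :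
    ω (addAdjoint hn X x) y = ω (X x) y + ω x (X y) := by
  simp only [addAdjoint, LinearMap.add_apply, LinearMap.id_apply, map_add, LinearMap.comp_apply,
    LinearEquiv.coe_coe, LinearEquiv.conj_apply_apply, LinearEquiv.symm_symm]
  rw [← LinearMap.BilinForm.toDual_def hn (m := (ω.toDual hn).symm _), LinearEquiv.apply_symm_apply]
  rfl

theorem addAdjoint_eq_zero_iff (hn : ω.Nondegenerate) {X : Module.End k W} :
    addAdjoint hn X = 0 ↔ X ∈ isometryLie ω := by
  constructor
  · intro h x y
    rw [← apply_addAdjoint hn, h]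
    simp
  · intro h
    refine eq_of_apply_eq hn fun x y => ?_
    rw [apply_addAdjoint, h x y]
    simp

theorem addAdjoint_alt (hω : ω.IsAlt) (hn : ω.Nondegenerate) (X : Module.End k W) (x : W) :
    ω (addAdjoint hn X x) x = 0 := by
  rw [apply_addAdjoint, ← hω.neg_eq (X x) x, add_neg_cancel]

theorem addAdjoint_of_alt (hω : ω.IsAlt) (hn : ω.Nondegenerate) {X : Module.End k W}
    (hX : ∀ x, ω (X x) x = 0) : addAdjoint hn X = (2 : k) • X := by
  refine eq_of_apply_eq hn fun x y => ?_
  rw [apply_addAdjoint, apply_eq_apply_of_alt hω hX x y, LinearMap.smul_apply, map_smul,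
    LinearMap.smul_apply, apply_eq_apply_of_alt hω hX x y, smul_eq_mul, two_mul]

theorem addAdjoint_conj (hn : ω.Nondegenerate) {g : W ≃ₗ[k] W} (hg : g ∈ isometryGroup ω)
    (X : Module.End k W) : addAdjoint hn (g.conj X) = g.conj (addAdjoint hn X) := by
  refine eq_of_apply_eq hn fun x y => ?_
  have h1 : ∀ a b, ω (g a) b = ω a (g.symm b) := fun a b => by
    rw [← hg a, LinearEquiv.apply_symm_apply]
  have h2 : ∀ a b, ω a (g b) = ω (g.symm a) b := fun a b => by
    rw [← hg (g.symm a), LinearEquiv.apply_symm_apply]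
  simp only [apply_addAdjoint, LinearEquiv.conj_apply_apply, h1, h2]

theorem symplecticClass_eq_iff (hn : ω.Nondegenerate) {X Y : Module.End k W} :
    symplecticClass ω X = symplecticClass ω Y ↔ addAdjoint hn X = addAdjoint hn Y := by
  rw [← sub_eq_zero (b := addAdjoint hn Y), ← map_sub, addAdjoint_eq_zero_iff]
  exact Submodule.Quotient.eq _

/-- The map induced by `addAdjoint` on the quotient by the symplectic Lie algebra. -/
noncomputable def quotientAddAdjoint (hn : ω.Nondegenerate) :
    LieQuotient (⊤ : Submodule k (Module.End k W)) (isometryLie ω) →ₗ[k] Module.End k W :=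
  Submodule.liftQ _ (addAdjoint hn ∘ₗ Submodule.subtype ⊤) fun _ hX =>
    (addAdjoint_eq_zero_iff hn).2 hX

theorem quotientAddAdjoint_class (hn : ω.Nondegenerate) (X : Module.End k W) :
    quotientAddAdjoint hn (symplecticClass ω X) = addAdjoint hn X := rfl

theorem mem_adjointOrbit_symplecticClass (hn : ω.Nondegenerate) {X : Module.End k W}
    {y : LieQuotient (⊤ : Submodule k (Module.End k W)) (isometryLie ω)} :
    y ∈ adjointOrbit (isometryGroup ω) (symplecticClass ω X) ↔
      ∃ g ∈ isometryGroup ω, y = symplecticClass ω (g.conj X) := by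
  constructor
  · rintro ⟨g, hg, X', Y, hY, hX, rfl⟩
    refine ⟨g, hg, ?_⟩
    rw [toLieQuotient_top, symplecticClass_eq_iff hn] at hX ⊢
    rw [hY, addAdjoint_conj hn hg, addAdjoint_conj hn hg, hX]
  · rintro ⟨g, hg, rfl⟩
    exact ⟨g, hg, ⟨X, trivial⟩, ⟨g.conj X, trivial⟩, rfl, rfl, rfl⟩

/-- For each c, det(c - (X + X*)) is a polynomial function on 𝔭 that is constant on the orbit, so it
equals its value c^(dim W) at 0. -/
theorem isNilpotent_addAdjoint_of_mem [Infinite k] (hn : ω.Nondegenerate)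
    {X : Module.End k W} (hX : symplecticClass ω X ∈
      nilpotentElements (⊤ : Submodule k (Module.End k W)) (isometryLie ω) (isometryGroup ω)) :
    IsNilpotent (addAdjoint hn X) := by
  rw [LinearMap.isNilpotent_iff_charpoly]
  refine Polynomial.funext fun c => ?_
  have h1 : (fun x => LinearMap.det (algebraMap k (Module.End k W) c +
      (-quotientAddAdjoint hn) x)) - algebraMap k _ ((addAdjoint hn X).charpoly.eval c) ∈
      polynomialFunctions k _ :=
    Subalgebra.sub_mem _ (det_mem_polynomialFunctions _ _) (Subalgebra.algebraMap_mem _ _)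
  have h2 := hX _ h1 (fun y hy => by
    obtain ⟨g, hg, rfl⟩ := (mem_adjointOrbit_symplecticClass hn).1 hy
    have h3 : algebraMap k (Module.End k W) c + -(g.conj (addAdjoint hn X)) =
        g.conj (algebraMap k (Module.End k W) c - addAdjoint hn X) := by
      rw [map_sub, sub_eq_add_neg]
      congr 1
      ext w
      simp [LinearEquiv.conj_apply_apply, Module.algebraMap_end_apply]
    simp only [Pi.sub_apply, Pi.algebraMap_apply, LinearMap.neg_apply, quotientAddAdjoint_class,
      addAdjoint_conj hn hg, h3, LinearMap.eval_charpoly, Algebra.algebraMap_self_apply]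
    rw [sub_eq_zero]
    exact LinearMap.det_conj (algebraMap k (Module.End k W) c - addAdjoint hn X) g)
  simp only [Pi.sub_apply, Pi.algebraMap_apply, map_zero, add_zero,
    Algebra.algebraMap_self_apply, sub_eq_zero] at h2
  rw [← h2, Algebra.algebraMap_eq_smul_one, LinearMap.det_smul]
  simp

/-- Induction on the rank: letting t → 0 in the torus conjugates of X puts the orbit of the
compression X₁ in the closure of the orbit of X. The rank drops because the projection kills e ∈ im
X. -/
theorem mem_nilpotentElements_of_alt [Infinite k] (hω : ω.IsAlt) (hn : ω.Nondegenerate) (r : ℕ) :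
    ∀ X : Module.End k W, X ∈ nilAlt ω → finrank k (LinearMap.range X) = r →
      symplecticClass ω X ∈ nilpotentElements (⊤ : Submodule k (Module.End k W))
        (isometryLie ω) (isometryGroup ω) := by
  induction r using Nat.strong_induction_on with
  | _ r ih =>
    rintro X ⟨hnil, hX⟩ hr
    by_cases h0 : X = 0
    · refine subset_zariskiClosure _ ((mem_adjointOrbit_symplecticClass hn).2
        ⟨1, Subgroup.one_mem _, ?_⟩)
      rw [h0]
      simp
    obtain ⟨y, hy, he⟩ := exists_ker_inf_range hnil h0
    set e := X y with hey
    obtain ⟨z, hz⟩ : ∃ z, ω e z ≠ 0 := by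
      by_contra! hc
      exact hy (hn.1 e hc)
    have hef : ω e ((ω e z)⁻¹ • z) = 1 := by rw [map_smul, smul_eq_mul, inv_mul_cancel₀ hz]
    have h := isHyperbolicPair_of_isAlt hω hef
    set f := (ω e z)⁻¹ • z
    set X₁ := h.proj * X * h.proj with hX₁
    have hnil₁ : X₁ ∈ nilAlt ω := by
      refine ⟨(isNilpotent_compression_iff h.proj_mul_proj (mul_proj_mul h hω hX he)).2 hnil,
        fun w => ?_⟩
      have h1 : h.proj (X (h.proj w)) = X w - ω w (X f) • e + ω w e • X f := by
        have h2 := expand_apply h (h.compress X) (X f) w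
        rw [expand_compress h hω hX he] at h2
        rw [h2]
        change _ = h.proj (X (h.proj w)) + _ - _ - _ + _
        module
      change ω (h.proj (X (h.proj w))) w = 0
      rw [h1]
      simp only [map_add, map_sub, map_smul, LinearMap.add_apply, LinearMap.sub_apply,
        LinearMap.smul_apply, smul_eq_mul, hX, ← hω.neg_eq e w, ← hω.neg_eq (X f) w]
      ring
    have hlt : finrank k (LinearMap.range X₁) < r := by
      have h1 : LinearMap.range X₁ ≤ (LinearMap.range X).map h.proj := by
        rintro _ ⟨w, rfl⟩
        exact ⟨X (h.proj w), ⟨_, rfl⟩, rfl⟩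
      refine (Submodule.finrank_mono h1).trans_lt ?_
      have h2 := (h.proj.domRestrict (LinearMap.range X)).finrank_range_add_finrank_ker
      rw [LinearMap.range_domRestrict, hr] at h2
      have h3 : 0 < finrank k (LinearMap.ker (h.proj.domRestrict (LinearMap.range X))) := by
        rw [Module.finrank_pos_iff_exists_ne_zero]
        refine ⟨⟨⟨e, y, rfl⟩, h.proj_left⟩, fun h4 => hy ?_⟩
        exact congrArg Subtype.val (congrArg Subtype.val h4)
      omega
    refine zariskiClosure_subset (fun z hz => ?_) (ih _ hlt X₁ hnil₁ rfl)
    obtain ⟨g, hg, rfl⟩ := (mem_adjointOrbit_symplecticClass hn).1 hz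
    refine mem_zariskiClosure_of_line (y := symplecticClass ω (g.conj (X - X₁))) fun t ht => ?_
    refine (mem_adjointOrbit_symplecticClass hn).2 ⟨g * h.torus (Units.mk0 t ht),
      Subgroup.mul_mem _ hg (h.torus_mem_isometryGroup _), ?_⟩
    have h1 : (g * h.torus (Units.mk0 t ht)).conj X = g.conj ((h.torus (Units.mk0 t ht)).conj X) :=
      rfl
    rw [h1, torus_conj_eq h hω hX he, map_add, map_smul, map_add, map_smul]
    rfl

theorem mem_nilpotentElements_iff_isNilpotent_addAdjoint [Infinite k] (h2 : (2 : k) ≠ 0)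
    (hω : ω.IsAlt) (hn : ω.Nondegenerate) (X : Module.End k W) :
    symplecticClass ω X ∈ nilpotentElements (⊤ : Submodule k (Module.End k W)) (isometryLie ω)
      (isometryGroup ω) ↔ IsNilpotent (addAdjoint hn X) := by
  refine ⟨isNilpotent_addAdjoint_of_mem hn, fun h => ?_⟩
  -- The self-adjoint representative of the class of X.
  set Y := (2 : k)⁻¹ • addAdjoint hn X with hY
  have halt : ∀ x, ω (Y x) x = 0 := fun x => by simp [hY, addAdjoint_alt hω hn]
  have h1 : symplecticClass ω X = symplecticClass ω Y := by
    rw [symplecticClass_eq_iff hn, addAdjoint_of_alt hω hn halt, hY, smul_inv_smul₀ h2]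
  rw [h1]
  exact mem_nilpotentElements_of_alt hω hn _ Y ⟨h.smul _, halt⟩ rfl

end SelfAdjoint

/-! ### Rational nilpotent points for (GL, Sp) -/

section Rational

variable {F k V : Type*} [Field F] [Field k] [Algebra F k] [AddCommGroup V]
  [Module F V] [FiniteDimensional F V]

theorem addAdjoint_baseChange {ω : LinearMap.BilinForm F V} (hn : ω.Nondegenerate)
    (hn' : (ω.baseChange k).Nondegenerate) (X : Module.End F V) :
    addAdjoint hn' (X.baseChange k) = (addAdjoint hn X).baseChange k := by
  refine eq_of_apply_eq hn' fun x y => ?_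
  rw [apply_addAdjoint]
  induction x with
  | zero => simp
  | add x x' hx hx' =>
    simp only [map_add, LinearMap.add_apply] at hx hx' ⊢
    rw [← hx, ← hx']
    ring
  | tmul a v =>
    induction y with
    | zero => simp
    | add y y' hy hy' =>
      simp only [map_add] at hy hy' ⊢
      rw [← hy, ← hy']
      ring
    | tmul b w =>
      simp only [LinearMap.baseChange_tmul, LinearMap.BilinForm.baseChange_tmul,
        apply_addAdjoint, add_smul]

theorem mem_nilpotentPointsGLSp_iff [Infinite k] (h2 : (2 : k) ≠ 0) {ω : LinearMap.BilinForm F V}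
    (hω : ω.IsAlt) (hn : ω.Nondegenerate) (X : Module.End F V) :
    symplecticClass ω X ∈ nilpotentPointsGLSp k ω ↔ IsNilpotent (addAdjoint hn X) := by
  have hω' := baseChange_isAlt (k := k) h2 hω
  have hn' := baseChange_nondegenerate (k := k) hn
  have key : ∀ X₀ : Module.End F V, symplecticClass (ω.baseChange k) (X₀.baseChange k) ∈
      nilpotentElements ⊤ (isometryLie (ω.baseChange k)) (isometryGroup (ω.baseChange k)) ↔
      IsNilpotent (addAdjoint hn X₀) := fun X₀ => by
    rw [mem_nilpotentElements_iff_isNilpotent_addAdjoint h2 hω' hn',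
      addAdjoint_baseChange hn hn', isNilpotent_baseChange_iff]
  constructor
  · rintro ⟨X₀, Y, hX₀, hY, hmem⟩
    rw [toLieQuotient_top, symplecticClass_eq_iff hn] at hX₀
    rwa [toLieQuotient_top, hY, key, hX₀] at hmem
  · intro h
    exact ⟨⟨X, trivial⟩, ⟨X.baseChange k, trivial⟩, rfl, rfl, (key X).2 h⟩

theorem natCard_nilpotentPointsGLSp [Infinite k] (h2 : (2 : F) ≠ 0) {ω : LinearMap.BilinForm F V}
    (hω : ω.IsAlt) (hn : ω.Nondegenerate) :
    Nat.card (nilpotentPointsGLSp k ω) = Nat.card (nilAlt ω) := by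
  have h2' : (2 : k) ≠ 0 := by
    rw [← map_ofNat (algebraMap F k) 2]
    exact (map_ne_zero _).2 h2
  refine (Nat.card_congr (Equiv.ofBijective (fun X : nilAlt ω =>
    (⟨symplecticClass ω X, (mem_nilpotentPointsGLSp_iff h2' hω hn _).2 ?_⟩ :
      nilpotentPointsGLSp k ω)) ⟨fun X Y hXY => ?_, ?_⟩)).symm
  · rw [addAdjoint_of_alt hω hn X.2.2]
    exact X.2.1.smul _
  · have h1 := (symplecticClass_eq_iff hn).1 (congrArg Subtype.val hXY)
    rw [addAdjoint_of_alt hω hn X.2.2, addAdjoint_of_alt hω hn Y.2.2] at h1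
    exact Subtype.ext (smul_right_injective _ h2 h1)
  · rintro ⟨x, hx⟩
    obtain ⟨X, rfl⟩ := symplecticClass_surjective ω x
    rw [mem_nilpotentPointsGLSp_iff h2' hω hn] at hx
    have halt : ∀ x, ω (((2 : F)⁻¹ • addAdjoint hn X) x) x = 0 := fun x => by
      simp [addAdjoint_alt hω hn]
    refine ⟨⟨(2 : F)⁻¹ • addAdjoint hn X, hx.smul _, halt⟩, Subtype.ext ?_⟩
    rw [symplecticClass_eq_iff hn, addAdjoint_of_alt hω hn halt, smul_inv_smul₀ h2]

end Rational

end SymmetricSpace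

/-! ### Nilpotency in 𝔰𝔬(V) / 𝔰𝔬(U) -/

namespace SymmetricSpace

open Module

section Orthogonal

variable {F V : Type*} [Field F] [AddCommGroup V] [Module F V]

theorem apply_mem_of_isometryLie [FiniteDimensional F V] (h2 : (2 : F) ≠ 0)
    {B : LinearMap.BilinForm F V} (hB : B.IsSymm)
    {U : Submodule F V} {v : V} (hv : ∀ u ∈ U, B u v = 0) (hU : ∀ w, ∃ u ∈ U, ∃ c : F, w = u + c • v)
    (hvv : B v v ≠ 0) {X : Module.End F V} (hX : X ∈ isometryLie B) : X v ∈ U := by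
  have h1 : B (X v) v = 0 := by
    have h := hX v v
    rw [hB.eq v (X v), ← two_mul] at h
    exact (mul_eq_zero.1 h).resolve_left h2
  obtain ⟨u, hu, c, hc⟩ := hU (X v)
  rw [hc, map_add, map_smul, LinearMap.add_apply, LinearMap.smul_apply, hv u hu, zero_add,
    smul_eq_mul] at h1
  rw [hc, (mul_eq_zero.1 h1).resolve_right hvv, zero_smul, add_zero]
  exact hu

theorem mem_orthogonal_iff_of_decomposition {B : LinearMap.BilinForm F V} (hB : B.IsSymm)
    (hn : B.Nondegenerate) {U : Submodule F V} {v : V} (hv : ∀ u ∈ U, B u v = 0)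
    (hU : ∀ w, ∃ u ∈ U, ∃ c : F, w = u + c • v) {w : V} :
    w ∈ B.orthogonal U ↔ ∃ c : F, w = c • v := by
  constructor
  · intro hw
    obtain ⟨u, hu, c, rfl⟩ := hU w
    refine ⟨c, ?_⟩
    suffices u = 0 by rw [this, zero_add]
    refine hn.1 u fun y => ?_
    obtain ⟨u', hu', c', rfl⟩ := hU y
    have h1 : B u' (u + c • v) = 0 := hw u' hu'
    rw [map_add, map_smul, hv u' hu', smul_zero, add_zero] at h1
    rw [map_add, map_smul, hv u hu, hB.eq u u', h1]
    simp
  · rintro ⟨c, rfl⟩ u hu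
    change B u (c • v) = 0
    rw [map_smul, hv u hu, smul_zero]

theorem mem_specialOrthogonalLieOf_iff {B : LinearMap.BilinForm F V} (hB : B.IsSymm)
    (hn : B.Nondegenerate) {U : Submodule F V} {v : V} (hv : ∀ u ∈ U, B u v = 0)
    (hU : ∀ w, ∃ u ∈ U, ∃ c : F, w = u + c • v) {X : Module.End F V} :
    X ∈ specialOrthogonalLieOf B U ↔ X ∈ isometryLie B ∧ X v = 0 := by
  constructor
  · intro h
    exact ⟨h.1, h.2 v ((mem_orthogonal_iff_of_decomposition hB hn hv hU).2 ⟨1, (one_smul _ _).symm⟩)⟩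
  · rintro ⟨h, hXv⟩
    refine ⟨h, fun w hw => ?_⟩
    obtain ⟨c, rfl⟩ := (mem_orthogonal_iff_of_decomposition hB hn hv hU).1 hw
    rw [map_smul, hXv, smul_zero]

/-- Evaluation at a vector orthogonal to `U`, on the quotient of the Lie algebra of `SO(V)` by
that of `SO(U)`. -/
def quotientEval (B : LinearMap.BilinForm F V) (U : Submodule F V) {v : V}
    (hv : v ∈ B.orthogonal U) : LieQuotient (isometryLie B) (specialOrthogonalLieOf B U) →ₗ[F] V :=
  Submodule.liftQ _ (LinearMap.applyₗ v ∘ₗ Submodule.subtype (isometryLie B)) fun _ hX => hX.2 v hv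

theorem quotientEval_mk {B : LinearMap.BilinForm F V} {U : Submodule F V} {v : V}
    (hv : v ∈ B.orthogonal U) (X : isometryLie B) :
    quotientEval B U hv (toLieQuotient (isometryLie B) (specialOrthogonalLieOf B U) X) = X.1 v :=
  rfl

theorem toLieQuotient_eq_iff {B : LinearMap.BilinForm F V} (hB : B.IsSymm)
    (hn : B.Nondegenerate) {U : Submodule F V} {v : V} (hv : ∀ u ∈ U, B u v = 0)
    (hU : ∀ w, ∃ u ∈ U, ∃ c : F, w = u + c • v) {X Y : isometryLie B} :
    toLieQuotient (isometryLie B) (specialOrthogonalLieOf B U) X =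
      toLieQuotient (isometryLie B) (specialOrthogonalLieOf B U) Y ↔ X.1 v = Y.1 v := by
  have h1 : toLieQuotient (isometryLie B) (specialOrthogonalLieOf B U) X =
      toLieQuotient (isometryLie B) (specialOrthogonalLieOf B U) Y ↔
      (X - Y).1 ∈ specialOrthogonalLieOf B U := Submodule.Quotient.eq _
  rw [h1, mem_specialOrthogonalLieOf_iff hB hn hv hU, ← sub_eq_zero (b := Y.1 v)]
  exact ⟨fun h => h.2, fun h => ⟨(X - Y).2, h⟩⟩

/-- SO(U) fixes v, so gXg⁻¹v = g(Xv), and B(Xv, Xv) is an invariant polynomial function on 𝔭 that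
vanishes at 0. -/
theorem isotropic_of_mem_nilpotentElements [FiniteDimensional F V] {B : LinearMap.BilinForm F V}
    {U : Submodule F V} {v : V} (hv : v ∈ B.orthogonal U) {X : isometryLie B}
    (hX : toLieQuotient (isometryLie B) (specialOrthogonalLieOf B U) X ∈
      nilpotentElements (isometryLie B) (specialOrthogonalLieOf B U) (specialOrthogonalOf B U)) :
    B (X.1 v) (X.1 v) = 0 := by
  have h1 := Subalgebra.sub_mem _
    (bilin_self_mem_polynomialFunctions B (quotientEval B U hv))
    (Subalgebra.algebraMap_mem _ (B (X.1 v) (X.1 v)))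
  have h2 := hX _ h1 (by
    rintro _ ⟨g, hg, X', Y, hY, hX', rfl⟩
    have h3 : X'.1 v = X.1 v := by rw [← quotientEval_mk hv, hX', quotientEval_mk hv]
    have h4 : g.symm v = v := by
      rw [LinearEquiv.symm_apply_eq]
      exact ((mem_fixingSubgroup_iff _).1 hg.2 v hv).symm
    simp only [Pi.sub_apply, Pi.algebraMap_apply, quotientEval_mk, Algebra.algebraMap_self_apply]
    rw [hY, LinearEquiv.conj_apply_apply, h4, hg.1.1, h3, sub_self])
  simpa using h2

/-- The torus of the pair (Xv, f) inside U fixes v and scales Xv by t, so the orbit contains all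
nonzero multiples of the class of X. -/
theorem mem_nilpotentElements_of_hyperbolic [FiniteDimensional F V] [Infinite F]
    {B : LinearMap.BilinForm F V}
    (hB : B.IsSymm) (hn : B.Nondegenerate) {U : Submodule F V} {v : V} (hv : ∀ u ∈ U, B u v = 0)
    (hU : ∀ w, ∃ u ∈ U, ∃ c : F, w = u + c • v) {X : isometryLie B} {f : V}
    (hXU : X.1 v ∈ U) (hf : f ∈ U) {ε : F} (h : IsHyperbolicPair B ε (X.1 v) f) :
    toLieQuotient (isometryLie B) (specialOrthogonalLieOf B U) X ∈
      nilpotentElements (isometryLie B) (specialOrthogonalLieOf B U) (specialOrthogonalOf B U) := by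
  refine mem_zariskiClosure_of_line
    (y := toLieQuotient (isometryLie B) (specialOrthogonalLieOf B U) X) fun t ht => ?_
  have hvmem : v ∈ hyperbolicComplement B (X.1 v) f :=
    mem_hyperbolicComplement.2 ⟨hv _ hXU, hv f hf⟩
  have hfix : h.torus (Units.mk0 t ht) v = v := h.torus_of_mem _ hvmem
  have hg := h.torus_mem_isometryGroup (Units.mk0 t ht)
  refine ⟨h.torus (Units.mk0 t ht), ⟨⟨hg, h.det_torus _⟩, (mem_fixingSubgroup_iff _).2 ?_⟩, X,
    ⟨(h.torus (Units.mk0 t ht)).conj X.1, conj_mem_isometryLie hg X.2⟩, rfl, rfl, ?_⟩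
  · intro w hw
    obtain ⟨c, rfl⟩ := (mem_orthogonal_iff_of_decomposition hB hn hv hU).1 hw
    change h.torus (Units.mk0 t ht) (c • v) = c • v
    rw [map_smul, hfix]
  · rw [zero_add, ← map_smul, toLieQuotient_eq_iff hB hn hv hU]
    have h1 : (h.torus (Units.mk0 t ht)).symm v = v := by
      rw [LinearEquiv.symm_apply_eq, hfix]
    change (h.torus (Units.mk0 t ht)).conj X.1 v = t • X.1 v
    rw [LinearEquiv.conj_apply_apply, h1, h.torus_left, Units.val_mk0]

theorem exists_orthogonal_vector [FiniteDimensional F V] {B : LinearMap.BilinForm F V}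
    (hB : B.IsSymm) (hn : B.Nondegenerate) {U : Submodule F V}
    (hU : finrank F U + 1 = finrank F V) (hnU : (B.restrict U).Nondegenerate) :
    ∃ v, (∀ u ∈ U, B u v = 0) ∧ (∀ w, ∃ u ∈ U, ∃ c : F, w = u + c • v) ∧ B v v ≠ 0 := by
  have hr : B.IsRefl := fun x y h => by rw [hB.eq]; exact h
  have hc := LinearMap.BilinForm.isCompl_orthogonal_of_restrict_nondegenerate hr hnU
  have h1 : finrank F (B.orthogonal U) = 1 := by
    rw [LinearMap.BilinForm.finrank_orthogonal hn]; omega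
  obtain ⟨⟨v, hv⟩, hv0, hspan⟩ := finrank_eq_one_iff'.1 h1
  have hdec : ∀ w, ∃ u ∈ U, ∃ c : F, w = u + c • v := fun w => by
    obtain ⟨u, hu, z, hz, rfl⟩ := Submodule.mem_sup.1
      (hc.sup_eq_top ▸ Submodule.mem_top : w ∈ U ⊔ B.orthogonal U)
    obtain ⟨c, hc⟩ := hspan ⟨z, hz⟩
    exact ⟨u, hu, c, congrArg (u + ·) (congrArg Subtype.val hc).symm⟩
  refine ⟨v, hv, hdec, fun h0 => hv0 (Subtype.ext (hn.2 v fun w => ?_))⟩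
  obtain ⟨u, hu, c, rfl⟩ := hdec w
  have h2 : B u v = 0 := hv u hu
  simp [h2, h0]

end Orthogonal

/-! ### Rational nilpotent points for (SO(V), SO(U)) -/

section Rational

variable {F k V : Type*} [Field F] [Field k] [Algebra F k] [Infinite k] [AddCommGroup V]
  [Module F V] [FiniteDimensional F V]

theorem mem_nilpotentPointsSO_iff (h2 : (2 : F) ≠ 0) {B : LinearMap.BilinForm F V}
    (hB : B.IsSymm) (hn : B.Nondegenerate) {U : Submodule F V}
    (hnU : (B.restrict U).Nondegenerate) {v : V} (hv : ∀ u ∈ U, B u v = 0)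
    (hU : ∀ w, ∃ u ∈ U, ∃ c : F, w = u + c • v) (hvv : B v v ≠ 0) (X : isometryLie B) :
    toLieQuotient (isometryLie B) (specialOrthogonalLieOf B U) X ∈ nilpotentPointsSO k B U ↔
      B (X.1 v) (X.1 v) = 0 := by
  have hB' : (B.baseChange k).IsSymm := ⟨fun x y => by
    have := baseChange_swap (k := k) (B := B) (ε := 1)
      (fun x y => by rw [one_mul]; exact hB.eq y x) y x
    rwa [map_one, one_mul] at this⟩
  have hn' := baseChange_nondegenerate (k := k) hn
  have hv' : ∀ u ∈ U.baseChange k, B.baseChange k u (1 ⊗ₜ v) = 0 := by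
    intro u hu
    rw [Submodule.baseChange_eq_span] at hu
    induction hu using Submodule.span_induction with
    | mem u hu =>
      obtain ⟨u, hu, rfl⟩ := hu
      simp [hv u hu]
    | zero => simp
    | add x y _ _ hx hy => simp [hx, hy]
    | smul a x _ hx => simp [hx]
  have hU' : ∀ w : k ⊗[F] V, ∃ u ∈ U.baseChange k, ∃ c : k, w = u + c • (1 ⊗ₜ[F] v) := by
    intro w
    induction w with
    | zero => exact ⟨0, Submodule.zero_mem _, 0, by simp⟩
    | add x y hx hy =>
      obtain ⟨u, hu, c, rfl⟩ := hx
      obtain ⟨u', hu', c', rfl⟩ := hy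
      exact ⟨u + u', Submodule.add_mem _ hu hu', c + c', by module⟩
    | tmul a w =>
      obtain ⟨u, hu, c, rfl⟩ := hU w
      refine ⟨a ⊗ₜ u, Submodule.tmul_mem_baseChange_of_mem a hu, c • a, ?_⟩
      rw [TensorProduct.tmul_add, TensorProduct.smul_tmul', smul_eq_mul, mul_one,
        TensorProduct.tmul_smul, TensorProduct.smul_tmul']
  constructor
  · rintro ⟨X₀, Y, hX₀, hY, hmem⟩
    have h1 := isotropic_of_mem_nilpotentElements (v := 1 ⊗ₜ v) hv' hmem
    rw [hY, LinearMap.baseChange_tmul, LinearMap.BilinForm.baseChange_tmul, mul_one,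
      (toLieQuotient_eq_iff hB hn hv hU).1 hX₀] at h1
    simpa using h1
  · intro h
    have hXU := apply_mem_of_isometryLie h2 hB hv hU hvv X.2
    have hmem : X.1.baseChange k ∈ isometryLie (B.baseChange k) := by
      intro x y
      induction x with
      | zero => simp
      | add x x' hx hx' =>
        simp only [map_add, LinearMap.add_apply] at hx hx' ⊢
        linear_combination hx + hx'
      | tmul a v =>
        induction y with
        | zero => simp
        | add y y' hy hy' =>
          simp only [map_add] at hy hy' ⊢
          linear_combination hy + hy'
        | tmul b w =>
          rw [LinearMap.baseChange_tmul, LinearMap.baseChange_tmul,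
            LinearMap.BilinForm.baseChange_tmul, LinearMap.BilinForm.baseChange_tmul, ← add_smul,
            X.2 v w, zero_smul]
    refine ⟨X, ⟨X.1.baseChange k, hmem⟩, rfl, rfl, ?_⟩
    by_cases h0 : X.1 v = 0
    · have h1 : toLieQuotient (isometryLie (B.baseChange k))
          (specialOrthogonalLieOf (B.baseChange k) (U.baseChange k)) ⟨X.1.baseChange k, hmem⟩ =
          0 := by
        rw [← map_zero (toLieQuotient _ _), toLieQuotient_eq_iff hB' hn' hv' hU']
        simp [h0]
      rw [h1]
      exact subset_zariskiClosure _ ⟨1, Subgroup.one_mem _, 0, 0, by simp, map_zero _, map_zero _⟩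
    · obtain ⟨f, hf⟩ := exists_isHyperbolicPair_of_isSymm (hB.restrict U) hnU h2
        (e := ⟨X.1 v, hXU⟩) (fun h' => h0 (congrArg Subtype.val h')) h
      have hf' : IsHyperbolicPair B 1 (X.1 v) f :=
        ⟨hf.sq, fun x y => by rw [one_mul]; exact hB.eq y x, hf.left, hf.right, hf.pair⟩
      have h1 := hf'.baseChange (k := k)
      exact mem_nilpotentElements_of_hyperbolic hB' hn' hv' hU'
        (by simpa using Submodule.tmul_mem_baseChange_of_mem (1 : k) hXU)
        (Submodule.tmul_mem_baseChange_of_mem (1 : k) f.2) (by simpa using h1)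

theorem natCard_nilpotentPointsSO (h2 : (2 : F) ≠ 0) {B : LinearMap.BilinForm F V}
    (hB : B.IsSymm) (hn : B.Nondegenerate) {U : Submodule F V}
    (hU : finrank F U + 1 = finrank F V) (hnU : (B.restrict U).Nondegenerate) :
    Nat.card (nilpotentPointsSO k B U) = Nat.card {u : U // B.restrict U u u = 0} := by
  obtain ⟨v, hv, hdec, hvv⟩ := exists_orthogonal_vector hB hn hU hnU
  have hq : ∀ x (hx : x ∈ nilpotentPointsSO k B U), ∃ X : isometryLie B,
      toLieQuotient (isometryLie B) (specialOrthogonalLieOf B U) X = x ∧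
      B (X.1 v) (X.1 v) = 0 := fun x hx => by
    obtain ⟨X, rfl⟩ := Submodule.mkQ_surjective _ x
    exact ⟨X, rfl, (mem_nilpotentPointsSO_iff h2 hB hn hnU hv hdec hvv X).1 hx⟩
  have hev : ∀ x : nilpotentPointsSO k B U, quotientEval B U (v := v) hv x.1 ∈ U ∧
      B (quotientEval B U (v := v) hv x.1) (quotientEval B U (v := v) hv x.1) = 0 := by
    rintro ⟨x, hx⟩
    obtain ⟨X, rfl, hX⟩ := hq x hx
    exact ⟨apply_mem_of_isometryLie h2 hB hv hdec hvv X.2, hX⟩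
  refine Nat.card_congr (Equiv.ofBijective (fun x => ⟨⟨_, (hev x).1⟩, (hev x).2⟩) ⟨?_, ?_⟩)
  · rintro ⟨x, hx⟩ ⟨y, hy⟩ hxy
    obtain ⟨X, rfl, -⟩ := hq x hx
    obtain ⟨Y, rfl, -⟩ := hq y hy
    have h1 : X.1 v = Y.1 v := congrArg (fun z => (z.1 : V)) hxy
    exact Subtype.ext ((toLieQuotient_eq_iff hB hn hv hdec).2 h1)
  · rintro ⟨⟨u, hu⟩, huu⟩
    -- The rank-two skew map attached to u ∧ v, normalised to send v to u; B u v = 0 is what makes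
    -- Xv = u.
    let X : Module.End F V := (B v v)⁻¹ • ((B v).smulRight u - (B u).smulRight v)
    have hX : X ∈ isometryLie B := by
      intro x y
      simp only [X, LinearMap.smul_apply, LinearMap.sub_apply, LinearMap.smulRight_apply, map_smul,
        map_sub, smul_eq_mul, hB.eq x u, hB.eq x v]
      ring
    have hXv : X v = u := by
      simp [X, hv u hu, hvv]
    refine ⟨⟨toLieQuotient (isometryLie B) (specialOrthogonalLieOf B U) ⟨X, hX⟩,
      (mem_nilpotentPointsSO_iff h2 hB hn hnU hv hdec hvv ⟨X, hX⟩).2 ?_⟩, ?_⟩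
    · change B (X v) (X v) = 0
      rw [hXv]
      exact huu
    · exact Subtype.ext (Subtype.ext hXv)

end Rational

theorem isSplitOn_iff_isSplitForm {F V : Type*} [Field F] [AddCommGroup V] [Module F V]
    {B : LinearMap.BilinForm F V} {U : Submodule F V} :
    IsSplitOn B U ↔ IsSplitForm (B.restrict U) := by
  constructor
  · rintro ⟨L, hL, hd, h⟩
    refine ⟨L.submoduleOf U, ?_, fun x hx y hy => h x hx y hy⟩
    rw [(Submodule.submoduleOfEquivOfLe hL).finrank_eq, hd]
  · rintro ⟨L, hd, h⟩
    refine ⟨L.map U.subtype, Submodule.map_subtype_le U L, ?_, ?_⟩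
    · rw [Submodule.finrank_map_subtype_eq, hd]
    · rintro _ ⟨x, hx, rfl⟩ _ ⟨y, hy, rfl⟩
      exact h x hx y hy

theorem four_mul_choose_two (n : ℕ) : 4 * n.choose 2 = 2 * n ^ 2 - 2 * n := by
  induction n with
  | zero => rfl
  | succ n ih =>
    rw [Nat.choose_succ_succ' n 1, Nat.choose_one_right, mul_add, ih]
    have h : 2 * n ≤ 2 * n ^ 2 := by nlinarith [Nat.le_self_pow two_ne_zero n]
    have h' : 2 * (n + 1) ^ 2 = 2 * n ^ 2 + 4 * n + 2 := by ring
    omega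

end SymmetricSpace

theorem mainTheorem11 (F : Type*) [Field F] [Finite F] (q : ℕ) (hq : Nat.card F = q)
    (hF : ringChar F ≠ 2) (k : Type*) [Field k] [Algebra F k] [IsAlgClosure F k] :
    (∀ (V : Type*) [AddCommGroup V] [Module F V] [FiniteDimensional F V] (n : ℕ)
        (_ : Module.finrank F V = 2 * n) (ω : LinearMap.BilinForm F V)
        (_ : ω.IsAlt) (_ : ω.Nondegenerate),
      Nat.card (SymmetricSpace.nilpotentPointsGLSp k ω) = q ^ (2 * n ^ 2 - 2 * n) ∧
        Even (2 * n ^ 2 - 2 * n)) ∧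
    (∀ (V : Type*) [AddCommGroup V] [Module F V] [FiniteDimensional F V] (N : ℕ)
        (_ : 2 ≤ N) (_ : Module.finrank F V = N) (B : LinearMap.BilinForm F V)
        (_ : B.IsSymm) (_ : B.Nondegenerate) (U : Submodule F V)
        (_ : Module.finrank F U + 1 = N) (_ : (B.restrict U).Nondegenerate),
      (Even N → Nat.card (SymmetricSpace.nilpotentPointsSO k B U) = q ^ (N - 2)) ∧
      (Odd N →
        (SymmetricSpace.IsSplitOn B U →
          (Nat.card (SymmetricSpace.nilpotentPointsSO k B U) : ℤ) =
            (q : ℤ) ^ (N - 2) + ((q : ℤ) ^ ((N - 1) / 2) - (q : ℤ) ^ ((N - 3) / 2))) ∧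
        (¬ SymmetricSpace.IsSplitOn B U →
          (Nat.card (SymmetricSpace.nilpotentPointsSO k B U) : ℤ) =
            (q : ℤ) ^ (N - 2) - ((q : ℤ) ^ ((N - 1) / 2) - (q : ℤ) ^ ((N - 3) / 2))))) := by
  have h2 : (2 : F) ≠ 0 := Ring.two_ne_zero hF
  have : IsAlgClosed k := IsAlgClosure.isAlgClosed F
  subst hq
  have hq0 : 0 < Nat.card F := Nat.card_pos
  refine ⟨fun V _ _ _ n hV ω hω hn => ⟨?_, ?_⟩, fun V _ _ _ N hN hV B hB hn U hU hnU => ?_⟩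
  · rw [SymmetricSpace.natCard_nilpotentPointsGLSp h2 hω hn,
      SymmetricSpace.natCard_nilAlt n V ω hV hω hn, SymmetricSpace.four_mul_choose_two]
  · rw [← SymmetricSpace.four_mul_choose_two]
    exact Even.mul_right (by decide) _
  rw [SymmetricSpace.natCard_nilpotentPointsSO h2 hB hn (by omega) hnU,
    SymmetricSpace.isSplitOn_iff_isSplitForm]
  refine ⟨fun hE => ?_, fun hO => ?_⟩
  · have hodd : Odd (Module.finrank F U) := by
      rw [← Nat.not_even_iff_odd, ← Nat.even_add_one, hU]
      exact hE
    have h := SymmetricSpace.natCard_isotropic_of_odd (hB.restrict U) hnU h2 hodd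
    refine Nat.eq_of_mul_eq_mul_left hq0 (h.trans ?_)
    rw [← pow_succ']
    congr 1
    omega
  · obtain ⟨r, rfl⟩ : ∃ r, N = 2 * (r + 1) + 1 := by
      obtain ⟨s, hs⟩ := hO
      exact ⟨s - 1, by omega⟩
    have h := SymmetricSpace.natCard_isotropic_of_even (hB.restrict U) hnU h2 (r + 1) (by omega)
    have hq0' : (Nat.card F : ℤ) ≠ 0 := by exact_mod_cast hq0.ne'
    rw [show 2 * (r + 1) + 1 - 2 = 2 * r + 1 by omega,
      show (2 * (r + 1) + 1 - 1) / 2 = r + 1 by omega,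
      show (2 * (r + 1) + 1 - 3) / 2 = r by omega]
    zify at h
    refine ⟨fun hs => mul_left_cancel₀ hq0' ?_, fun hs => mul_left_cancel₀ hq0' ?_⟩
    · linear_combination h.1 hs
    · linear_combination h.2 hs
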